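/- Let $N\ge 1$, let $K(y)=e^{|y|^2/4}$ on $\mathbb{R}^N$, and let $L^2(K)$ be the real Hilbert space of (classes of) measurable functions $v:\mathbb{R}^N\to\mathbb{R}$ with $\|v\|_K^2=\int |v|^2K\,dy<\infty$, with scalar product $(v,w)_K=\int vwK\,dy$. For $m\in\mathbb{N}$ let $H^m(K)$ be the space of $v$ whose weak derivatives $D^\alpha v$, $|\alpha|\le m$, lie in $L^2(K)$, with the norm $\|v\|_{m,K}^2=\sum_{|\alpha|\le m}\|D^\alpha v\|_K^2$. Let $Lv=-\Delta v-\frac{y\cdot\nabla v}{2}$ on $L^2(K)$, with domain $H^2(K)$, let $\varphi_1(y)=(4\pi)^{-N/4}e^{-|y|^2/4}$ be its first eigenfunction, $E_1=\mathrm{Span}\{\varphi_1\}$, and let $E_1^\perp$ be the orthogonal complement of $E_1$ in $L^2(K)$. Consider $$v_s+Lv-\tfrac N2 v=0\ \text{ in }\mathbb{R}^N\times(0,\infty),\qquad v(0)=u_0. \tag{1}$$ Then there is a strongly continuous semigroup of contractions $\{S(s)\}_{s\ge0}$ on $L^2(K)$, generated by $-(L-\frac N2I)$ with domain $H^2(K)$,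 such that the following holds. (i) For every $u_0\in L^2(K)$, $v(s)=S(s)u_0$ is the unique $v\in C([0,\infty);L^2(K))$ with $v(0)=u_0$ that satisfies the equation in (1) in the sense of distributions on $\mathbb{R}^N\times(0,\infty)$. Moreover $v\in C^\infty((0,\infty);H^m(K))$ for all $m\in\mathbb{N}$, and the equation holds in $L^2(K)$ for every $s>0$. (ii) For every $u_0\in L^2(K)$, $(v(s),\varphi_1)_K=(u_0,\varphi_1)_K$ for all $s\ge0$. (iii) There is $C>0$ with $\|v(s)\|_K\le Ce^{-s/2}\|u_0\|_K$ for all $s\ge0$ and $u_0\in E_1^\perp$; and for every $m\in\mathbb{N}$ there is $C_m>0$, independent of the initial data, with $\|v(s)\|_{m,K}\le C_me^{-s/2}\|u_0\|_K$ for all $s\ge1$ and $u_0\in E_1^\perp$. (iv) For all $s>0$ and $u_0\in E_1^\perp$, $$\Bigl\|\Bigl(L-\frac N2\Bigr)v(s)\Bigr\|_K\le\frac1{\sqrt2\,s}\|u_0\|_K,\qquad \|\nabla v(s)\|_K^2-\frac N2\|v(s)\|_K^2\le\frac1{2s}\|u_0\|_K^2 .$$ -/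

import Mathlib

open Set Filter Topology MeasureTheory
open scoped ContDiff InnerProductSpace Laplacian

namespace SimilarityHeat

/-- The Euclidean space `ℝ^N`. -/
abbrev Space (N : ℕ) : Type := EuclideanSpace ℝ (Fin N)

/-- The weight `K(y) = exp(|y|² / 4)`. -/
noncomputable def weight (N : ℕ) (y : Space N) : ℝ := Real.exp (‖y‖ ^ 2 / 4)

/-- The measure `K(y) dy`. -/
noncomputable def weightMeasure (N : ℕ) : Measure (Space N) :=
  (volume : Measure (Space N)).withDensity fun y => ENNReal.ofReal (weight N y)

/-- The real Hilbert space `L²(K)`, with scalar product `∫ v w K dy` and norm `‖·‖_K`.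
The measures `K dy` and `dy` have the same null sets, and `K ≥ 1`. -/
abbrev L2K (N : ℕ) : Type := Lp ℝ 2 (weightMeasure N)

theorem measurable_weight (N : ℕ) :
    Measurable fun y : Space N => ENNReal.ofReal (weight N y) := by
  unfold weight
  fun_prop

theorem volume_le_weightMeasure (N : ℕ) : (volume : Measure (Space N)) ≤ weightMeasure N := by
  conv_lhs => rw [← withDensity_one (μ := (volume : Measure (Space N)))]
  refine withDensity_mono (Eventually.of_forall fun y => ?_)
  simp only [Pi.one_apply, weight, ENNReal.one_le_ofReal]
  exact Real.one_le_exp (by positivity)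

theorem volume_absolutelyContinuous (N : ℕ) :
    (volume : Measure (Space N)) ≪ weightMeasure N :=
  Measure.absolutelyContinuous_of_le (volume_le_weightMeasure N)

/-- The partial derivative `∂φ/∂y_i`. -/
noncomputable def partialD {N : ℕ} (i : Fin N) (φ : Space N → ℝ) : Space N → ℝ :=
  fun y => fderiv ℝ φ y (EuclideanSpace.single i 1)

/-- The derivative `D^α φ = ∂_1^{α_1} ⋯ ∂_N^{α_N} φ` of a smooth function. -/
noncomputable def multiD {N : ℕ} (α : Fin N → ℕ) (φ : Space N → ℝ) : Space N → ℝ :=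
  (List.finRange N).foldr (fun i ψ => (partialD i)^[α i] ψ) φ

theorem partialD_smooth {N : ℕ} (i : Fin N) {φ : Space N → ℝ}
    (h : ContDiff ℝ ∞ φ ∧ HasCompactSupport φ) :
    ContDiff ℝ ∞ (partialD i φ) ∧ HasCompactSupport (partialD i φ) := by
  constructor
  · exact (h.1.fderiv_right (m := ∞) (by simp)).clm_apply contDiff_const
  · exact h.2.fderiv_apply ℝ _

theorem multiD_smooth {N : ℕ} (α : Fin N → ℕ) {φ : Space N → ℝ}
    (h : ContDiff ℝ ∞ φ ∧ HasCompactSupport φ) :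
    ContDiff ℝ ∞ (multiD α φ) ∧ HasCompactSupport (multiD α φ) := by
  unfold multiD
  induction List.finRange N with
  | nil => exact h
  | cons i l ih =>
    rw [List.foldr_cons]
    generalize α i = k
    induction k with
    | zero => exact ih
    | succ k ihk =>
      rw [Function.iterate_succ_apply']
      exact partialD_smooth i ihk

/-- `w = D^α v` in the sense of distributions on `ℝ^N`. -/
def HasWeakDeriv {N : ℕ} (α : Fin N → ℕ) (v w : L2K N) : Prop :=
  ∀ φ : Space N → ℝ, ContDiff ℝ ∞ φ → HasCompactSupport φ →
    ∫ y, v y * multiD α φ y = (-1 : ℝ) ^ (∑ i, α i) * ∫ y, w y * φ y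

theorem integrable_mul_test {N : ℕ} (v : L2K N) {φ : Space N → ℝ}
    (h1 : ContDiff ℝ ∞ φ) (h2 : HasCompactSupport φ) :
    Integrable (fun y => v y * φ y) (volume : Measure (Space N)) :=
  ((Lp.memLp v).mono_measure (volume_le_weightMeasure N)).integrable_mul
    (q := 2) (h1.continuous.memLp_of_hasCompactSupport h2)

theorem HasWeakDeriv.add {N : ℕ} {α : Fin N → ℕ} {v w v' w' : L2K N}
    (h : HasWeakDeriv α v w) (h' : HasWeakDeriv α v' w') :
    HasWeakDeriv α (v + v') (w + w') := by
  intro φ h1 h2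
  have key : ∀ (a b : L2K N) (ψ : Space N → ℝ), ContDiff ℝ ∞ ψ → HasCompactSupport ψ →
      ∫ y, (a + b : L2K N) y * ψ y = (∫ y, a y * ψ y) + ∫ y, b y * ψ y := by
    intro a b ψ p1 p2
    rw [← integral_add (integrable_mul_test a p1 p2) (integrable_mul_test b p1 p2)]
    refine integral_congr_ae ?_
    filter_upwards [(volume_absolutelyContinuous N).ae_le (Lp.coeFn_add a b)] with y hy
    rw [hy, Pi.add_apply, add_mul]
  obtain ⟨m1, m2⟩ := multiD_smooth α ⟨h1, h2⟩
  rw [key v v' _ m1 m2, key w w' _ h1 h2, h φ h1 h2, h' φ h1 h2, mul_add]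

theorem HasWeakDeriv.smul {N : ℕ} {α : Fin N → ℕ} {v w : L2K N} (c : ℝ)
    (h : HasWeakDeriv α v w) : HasWeakDeriv α (c • v) (c • w) := by
  intro φ h1 h2
  have key : ∀ (a : L2K N) (ψ : Space N → ℝ),
      ∫ y, (c • a : L2K N) y * ψ y = c * ∫ y, a y * ψ y := by
    intro a ψ
    rw [← integral_const_mul]
    refine integral_congr_ae ?_
    filter_upwards [(volume_absolutelyContinuous N).ae_le (Lp.coeFn_smul c a)] with y hy
    rw [hy, Pi.smul_apply, smul_eq_mul, mul_assoc]
  rw [key, key, h φ h1 h2]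
  ring

theorem HasWeakDeriv.zero {N : ℕ} {α : Fin N → ℕ} :
    HasWeakDeriv α (0 : L2K N) 0 := by
  have h0 : (0 : L2K N) = (0 : ℝ) • (0 : L2K N) := by simp
  intro φ h1 h2
  have key : ∀ ψ : Space N → ℝ, ∫ y, (0 : L2K N) y * ψ y = 0 := by
    intro ψ
    refine integral_eq_zero_of_ae ?_
    filter_upwards [(volume_absolutelyContinuous N).ae_le
      (Lp.coeFn_zero ℝ 2 (weightMeasure N))] with y hy
    rw [hy]
    simp
  rw [key, key, mul_zero]

/-- The multi-indices `α ∈ ℕ^N` with `|α| ≤ m`. -/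
def multiIndices (N m : ℕ) : Finset (Fin N → ℕ) :=
  (Fintype.piFinset fun _ : Fin N => Finset.range (m + 1)).filter fun α => ∑ i, α i ≤ m

theorem mem_multiIndices {N m : ℕ} {α : Fin N → ℕ} :
    α ∈ multiIndices N m ↔ ∑ i, α i ≤ m := by
  simp only [multiIndices, Finset.mem_filter, Fintype.mem_piFinset, Finset.mem_range,
    and_iff_right_iff_imp]
  intro h i
  have := Finset.single_le_sum (f := α) (fun _ _ => Nat.zero_le _) (Finset.mem_univ i)
  omega

/-- The multi-index `0`. -/
def zeroIndex (N m : ℕ) : multiIndices N m := ⟨0, mem_multiIndices.2 (by simp)⟩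

/-- The weighted Sobolev space `H^m(K)`. An element is the family `(D^α v)_{|α| ≤ m}` of the weak
derivatives of a function `v`, all of them in `L²(K)`; the family is determined by its entry `v` at
`α = 0`. The norm inherited from the Hilbert sum is `(∑_{|α| ≤ m} ‖D^α v‖_K²)^{1/2}`. -/
noncomputable def HK (N m : ℕ) : Submodule ℝ (PiLp 2 fun _ : multiIndices N m => L2K N) where
  carrier := {V | ∀ α : multiIndices N m, HasWeakDeriv α.1 (V (zeroIndex N m)) (V α)}
  add_mem' h h' α := (h α).add (h' α)
  zero_mem' _ := HasWeakDeriv.zero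
  smul_mem' c _ h α := (h α).smul c

/-- The inclusion of `H^m(K)` in `L²(K)`. -/
noncomputable def toL2K {N m : ℕ} (V : HK N m) : L2K N := V.1 (zeroIndex N m)

/-- `f = L v = -Δ v - (y · ∇ v) / 2`, where `v` lies in the domain `H²(K)` of `L` and `f` in
`L²(K)`. -/
def IsL {N : ℕ} (v f : L2K N) : Prop :=
  (∃ V : HK N 2, toL2K V = v) ∧
  ∃ g h : Fin N → L2K N,
    (∀ i, HasWeakDeriv (Pi.single i 1) v (g i)) ∧
    (∀ i, HasWeakDeriv (Pi.single i 2) v (h i)) ∧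
    ∀ᵐ y, f y = -(∑ i, h i y) - (∑ i, y i * g i y) / 2

/-- `v ∈ C([0,∞); L²(K))`, `v(0) = u₀`, and
`v_s - Δ v - (y · ∇ v) / 2 - (N / 2) v = 0` in the sense of distributions on `(0,∞) × ℝ^N`.
The formal adjoint of `v ↦ -(y · ∇ v) / 2` is `φ ↦ div (y φ) / 2 = (N φ + y · ∇ φ) / 2`. -/
structure IsSolution {N : ℕ} (u₀ : L2K N) (v : ℝ → L2K N) : Prop where
  continuousOn : ContinuousOn v (Ici 0)
  initial : v 0 = u₀
  equation : ∀ φ : ℝ → Space N → ℝ, ContDiff ℝ ∞ (Function.uncurry φ) →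
    HasCompactSupport (Function.uncurry φ) →
    tsupport (Function.uncurry φ) ⊆ Ioi 0 ×ˢ univ →
    ∫ s in Ioi (0 : ℝ), ∫ y, v s y *
      (-deriv (fun σ => φ σ y) s - (Δ (φ s)) y
        + (N * φ s y + fderiv ℝ (φ s) y y) / 2 - N / 2 * φ s y) = 0

/-- `v ∈ C^∞((0,∞); H^m(K))`. -/
def SmoothInHK {N : ℕ} (m : ℕ) (v : ℝ → L2K N) : Prop :=
  ∃ V : ℝ → HK N m, ContDiffOn ℝ ∞ V (Ioi 0) ∧ ∀ s, 0 < s → toL2K (V s) = v s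

/-- `(S(s))_{s ≥ 0}` is the strongly continuous semigroup of contractions on `L²(K)` generated by
`L - N/2` in the sign convention of the equation `v' + (L - N/2) v = 0`: the right derivative of
`S(s) u` at `s = 0` exists exactly for `u` in the domain of `L`, and equals `-(L u - (N/2) u)`. -/
structure IsHeatSemigroup {N : ℕ} (S : ℝ → L2K N →L[ℝ] L2K N) : Prop where
  zero : S 0 = ContinuousLinearMap.id ℝ (L2K N)
  add : ∀ s t, 0 ≤ s → 0 ≤ t → S (s + t) = (S s).comp (S t)
  continuousOn : ∀ u, ContinuousOn (fun s => S s u) (Ici 0)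
  contraction : ∀ s, 0 ≤ s → ‖S s‖ ≤ 1
  generator : ∀ u w : L2K N,
    Tendsto (fun h : ℝ => h⁻¹ • (S h u - u)) (𝓝[>] 0) (𝓝 w) ↔
      ∃ f, IsL u f ∧ w = -(f - ((N : ℝ) / 2) • u)

/-- The function `(4π)^{-N/4} exp(-|y|² / 4)`. -/
noncomputable def phiOneFun (N : ℕ) (y : Space N) : ℝ :=
  (4 * Real.pi) ^ (-(N : ℝ) / 4) * Real.exp (-‖y‖ ^ 2 / 4)

theorem integrable_gauss (N : ℕ) :
    Integrable (fun y : Space N => Real.exp (-(1 / 4) * ‖y‖ ^ 2)) := by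
  have h := (GaussianFourier.integrable_cexp_neg_mul_sq_norm_add (V := Space N)
    (b := (1 / 4 : ℂ)) (by norm_num) 0 0).norm
  refine h.congr (Eventually.of_forall fun y => ?_)
  simp only [Complex.norm_exp, zero_mul, add_zero]
  congr 1
  have : (-(1 / 4 : ℂ) * (‖y‖ : ℂ) ^ 2) = ((-(1 / 4) * ‖y‖ ^ 2 : ℝ) : ℂ) := by push_cast; ring
  rw [this, Complex.ofReal_re]

theorem memLp_phiOneFun (N : ℕ) : MemLp (phiOneFun N) 2 (weightMeasure N) := by
  have hc : Continuous (phiOneFun N) := by unfold phiOneFun; fun_prop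
  rw [memLp_two_iff_integrable_sq hc.aestronglyMeasurable, weightMeasure,
    integrable_withDensity_iff_integrable_smul' (measurable_weight N)
      (Eventually.of_forall fun _ => ENNReal.ofReal_lt_top)]
  refine ((integrable_gauss N).const_mul (((4 * Real.pi) ^ (-(N : ℝ) / 4)) ^ 2)).congr
    (Eventually.of_forall fun y => ?_)
  simp only [phiOneFun, weight, smul_eq_mul]
  rw [ENNReal.toReal_ofReal (Real.exp_pos _).le, mul_pow, ← Real.exp_nat_mul, mul_left_comm,
    ← Real.exp_add]
  congr 2
  push_cast
  ring

/-- The first eigenfunction `φ₁` of `L`, normalised in `L²(K)`. -/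
noncomputable def phiOne (N : ℕ) : L2K N := (memLp_phiOneFun N).toLp (phiOneFun N)

/-- The first eigenspace `E₁`, spanned by `φ₁`. -/
noncomputable def firstEigenspace (N : ℕ) : Submodule ℝ (L2K N) := Submodule.span ℝ {phiOne N}

end SimilarityHeat

/-! The operator `L` is diagonal in an explicit orthonormal basis. The derivatives of the Gaussian
`φ₁` are Hermite polynomials times `φ₁`; after normalisation they form a Hilbert basis `e_β` of
`L²(K)`, with `(L - N/2) e_β = λ_β e_β`, `λ_β = |β|/2`, and `D^α e_β = κ e_{β+α}`. So the semigroup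
is the multiplier `exp(-λ_β s)`, weak derivatives are weighted shifts, and every estimate is a bound
on a family of real numbers combined with Parseval.

Completeness of the basis (`eq_zero_of_integral_mul_hermiteTensor`): if `v` is orthogonal to all
`e_β`, then `v` integrates to zero against every power `(y · ξ)^k`. As `v` lies in `L²(K)`, the
exponential series may be integrated term by term, so the Fourier transform of `v` vanishes.

The link between `L` and the basis is `WeakL.inner_hermiteE`: if `L u = f` merely as distributions,
then the coefficients satisfy `f_β = (λ_β + N/2) u_β`. The test function wanted here is `K e_β`, a
multiple of a Hermite polynomial, which lacks compact support; a cutoff argument admits it. In the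
other direction, the multiplier `(1 + 2 λ_β)⁻¹` maps `L²(K)` into `H²(K)`, because the shift factors
grow like `|β|^{|α|/2}`. The two facts together identify the domain of the generator with `H²(K)`
(`generator_heatS`).

Smoothing holds because `exp(-λ_β s)` beats every power of `|β|`. Decay holds because `λ_β ≥ 1/2`
for `β ≠ 0`, and orthogonality to `φ₁` removes `β = 0`. The bounds in (iv) are bounds on `x
exp(-x)`.

For uniqueness (`IsSolution.eq_heatS`), a solution averaged in time against `θ` satisfies a weak
equation for `L`. Its coefficients therefore satisfy `c' = -λ_β c` as distributions in time, and
`exp(λ_β s) c(s)` is constant. -/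

namespace SimilarityHeat

/-! ### Tensor products of polynomials, with and without a Gaussian factor -/

/-- The function `y ↦ ∏ j, q_j (y_j)`. -/
noncomputable def polyTensor {N : ℕ} (q : Fin N → Polynomial ℝ) (y : Space N) : ℝ :=
  ∏ j, (q j).eval (y j)

/-- The function `y ↦ (∏ j, q_j (y_j)) φ₁(y)`. -/
noncomputable def gaussTensor {N : ℕ} (q : Fin N → Polynomial ℝ) (y : Space N) : ℝ :=
  polyTensor q y * phiOneFun N y

theorem contDiff_polyTensor {N : ℕ} (q : Fin N → Polynomial ℝ) : ContDiff ℝ ∞ (polyTensor q) := by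
  unfold polyTensor
  refine contDiff_prod fun j _ => ?_
  exact (Polynomial.contDiff_aeval (q j) ∞).comp (contDiff_piLp_apply (p := 2) (i := j))

theorem contDiff_phiOneFun (N : ℕ) : ContDiff ℝ ∞ (phiOneFun N) := by
  unfold phiOneFun
  exact contDiff_const.mul (((contDiff_norm_sq ℝ).neg.div_const 4).exp)

theorem contDiff_gaussTensor {N : ℕ} (q : Fin N → Polynomial ℝ) : ContDiff ℝ ∞ (gaussTensor q) :=
  (contDiff_polyTensor q).mul (contDiff_phiOneFun N)

theorem polyTensor_update {N : ℕ} (q : Fin N → Polynomial ℝ) (i : Fin N) (r : Polynomial ℝ)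
    (y : Space N) :
    polyTensor (Function.update q i r) y =
      r.eval (y i) * ∏ j ∈ Finset.univ.erase i, (q j).eval (y j) := by
  unfold polyTensor
  rw [← Finset.mul_prod_erase _ _ (Finset.mem_univ i), Function.update_self]
  congr 1
  refine Finset.prod_congr rfl fun j hj => ?_
  rw [Function.update_of_ne (Finset.ne_of_mem_erase hj)]

theorem polyTensor_eq {N : ℕ} (q : Fin N → Polynomial ℝ) (i : Fin N) (y : Space N) :
    polyTensor q y = (q i).eval (y i) * ∏ j ∈ Finset.univ.erase i, (q j).eval (y j) := by
  rw [← polyTensor_update, Function.update_eq_self]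

theorem partialD_polyTensor {N : ℕ} (i : Fin N) (q : Fin N → Polynomial ℝ) :
    partialD i (polyTensor q) = polyTensor (Function.update q i (q i).derivative) := by
  funext y
  have h : ∀ j ∈ Finset.univ, HasFDerivAt (fun y : Space N => (q j).eval (y j))
      ((q j).derivative.eval (y j) • (EuclideanSpace.proj j : Space N →L[ℝ] ℝ)) y := fun j _ =>
    ((q j).hasDerivAt (y j)).comp_hasFDerivAt (f := fun y : Space N => y j) y
      (EuclideanSpace.proj j : Space N →L[ℝ] ℝ).hasFDerivAt
  have h' := HasFDerivAt.finsetProd h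
  rw [partialD, show polyTensor q = fun y => ∏ j, (q j).eval (y j) from rfl, h'.fderiv,
    polyTensor_update]
  simp only [sum_apply, smul_apply, PiLp.proj_apply,
    PiLp.single_apply, smul_eq_mul]
  rw [Finset.sum_eq_single i]
  · simp [mul_comm]
  · intro j _ hj
    simp [hj]
  · simp

theorem fderiv_apply_eq_sum {N : ℕ} (φ : Space N → ℝ) (y z : Space N) :
    fderiv ℝ φ y z = ∑ i, z i * partialD i φ y := by
  conv_lhs => rw [← (EuclideanSpace.basisFun (Fin N) ℝ).sum_repr z]
  simp [partialD]

theorem partialD_mul {N : ℕ} (i : Fin N) {φ ψ : Space N → ℝ} (hφ : ContDiff ℝ ∞ φ)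
    (hψ : ContDiff ℝ ∞ ψ) :
    partialD i (fun y => φ y * ψ y) = fun y => partialD i φ y * ψ y + φ y * partialD i ψ y := by
  funext y
  unfold partialD
  rw [fderiv_fun_mul (hφ.differentiable (by simp) y) (hψ.differentiable (by simp) y)]
  simp only [add_apply, smul_apply, smul_eq_mul]
  ring

theorem partialD_phiOneFun {N : ℕ} (i : Fin N) (y : Space N) :
    partialD i (phiOneFun N) y = -(y i / 2) * phiOneFun N y := by
  have h1 := (hasStrictFDerivAt_norm_sq y).hasFDerivAt.const_mul (-(1 / 4) : ℝ)
  have h := (h1.exp).const_mul ((4 * Real.pi) ^ (-(N : ℝ) / 4))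
  have h0 : phiOneFun N = fun y => (4 * Real.pi) ^ (-(N : ℝ) / 4) *
      Real.exp (-(1 / 4) * ‖y‖ ^ 2) := by
    funext z
    rw [phiOneFun]
    congr 2
    ring
  rw [partialD, h0, h.fderiv]
  simp only [smul_apply, smul_eq_mul, innerSL_apply_apply, EuclideanSpace.inner_single_right]
  simp
  ring

/-- The operator `q ↦ q' - (X / 2) q`, conjugate to `d/dx` by the Gaussian. -/
noncomputable def raise (q : Polynomial ℝ) : Polynomial ℝ :=
  q.derivative - Polynomial.C (1 / 2) * Polynomial.X * q

theorem eval_raise (q : Polynomial ℝ) (x : ℝ) :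
    (raise q).eval x = q.derivative.eval x - x / 2 * q.eval x := by
  simp only [raise, Polynomial.eval_sub, Polynomial.eval_mul, Polynomial.eval_C, Polynomial.eval_X]
  ring

theorem partialD_gaussTensor {N : ℕ} (i : Fin N) (q : Fin N → Polynomial ℝ) :
    partialD i (gaussTensor q) = gaussTensor (Function.update q i (raise (q i))) := by
  rw [show gaussTensor q = fun y => polyTensor q y * phiOneFun N y from rfl,
    partialD_mul i (contDiff_polyTensor q) (contDiff_phiOneFun N), partialD_polyTensor]
  funext y
  rw [partialD_phiOneFun, gaussTensor, polyTensor_update, polyTensor_update, eval_raise,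
    polyTensor_eq q i]
  ring

/-! ### Hermite polynomials for the weight `exp(-x² / 4)` -/

/-- The polynomials `p_n` with `(d/dx)^n exp(-x²/4) = p_n(x) exp(-x²/4)`. -/
noncomputable def hermiteP : ℕ → Polynomial ℝ
  | 0 => 1
  | n + 1 => raise (hermiteP n)

/-- The lowering relation. It comes from the commutator `[d/dx, raise] = -1/2`, which contributes
`-1/2` at each step of the induction. -/
theorem derivative_hermiteP_succ (n : ℕ) :
    (hermiteP (n + 1)).derivative = Polynomial.C (-((n : ℝ) + 1) / 2) * hermiteP n := by
  induction n with
  | zero =>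
    simp [hermiteP, raise, Polynomial.derivative_mul, Polynomial.derivative_X]
    rw [← Polynomial.C_neg]
    congr 1
    norm_num
  | succ n ih =>
    refine Polynomial.funext fun x => ?_
    have h1 : hermiteP (n + 1 + 1) = raise (hermiteP (n + 1)) := rfl
    have h2 : (hermiteP (n + 1)).eval x =
      (hermiteP n).derivative.eval x - x / 2 * (hermiteP n).eval x := eval_raise _ _
    rw [h1, raise, Polynomial.derivative_sub, Polynomial.derivative_mul, Polynomial.derivative_mul,
      ih, Polynomial.derivative_mul]
    simp only [Polynomial.derivative_C, Polynomial.derivative_X, Polynomial.eval_sub,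
      Polynomial.eval_add, Polynomial.eval_mul, Polynomial.eval_C, Polynomial.eval_X,
      Polynomial.eval_one, Polynomial.eval_zero, h2]
    push_cast
    ring

theorem eval_derivative_hermiteP_succ (n : ℕ) (x : ℝ) :
    (hermiteP (n + 1)).derivative.eval x = -((n : ℝ) + 1) / 2 * (hermiteP n).eval x := by
  rw [derivative_hermiteP_succ]
  simp

theorem eval_hermiteP_succ (n : ℕ) (x : ℝ) :
    (hermiteP (n + 1)).eval x = (hermiteP n).derivative.eval x - x / 2 * (hermiteP n).eval x :=
  eval_raise _ _

/-- Raising after lowering. This is the eigenvalue equation for the polynomials without the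
Gaussian, hence for the `dy`-adjoint of `L`. -/
theorem hermiteP_ode (n : ℕ) (x : ℝ) :
    -(hermiteP n).derivative.derivative.eval x + x / 2 * (hermiteP n).derivative.eval x =
      n / 2 * (hermiteP n).eval x := by
  cases n with
  | zero => simp [hermiteP]
  | succ n =>
    rw [derivative_hermiteP_succ, Polynomial.derivative_mul]
    simp only [Polynomial.derivative_C, Polynomial.eval_add, Polynomial.eval_mul, Polynomial.eval_C,
      Polynomial.eval_zero, eval_hermiteP_succ]
    push_cast
    ring

theorem hermiteP_recurrence (n : ℕ) (x : ℝ) :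
    (hermiteP (n + 2)).eval x + x / 2 * (hermiteP (n + 1)).eval x +
      ((n : ℝ) + 1) / 2 * (hermiteP n).eval x = 0 := by
  rw [eval_hermiteP_succ, eval_derivative_hermiteP_succ]
  ring

theorem integrable_polynomial_mul_gauss (q : Polynomial ℝ) :
    Integrable fun x : ℝ => q.eval x * Real.exp (-(1 / 4) * x ^ 2) := by
  induction q using Polynomial.induction_on' with
  | add p q hp hq =>
    simp only [Polynomial.eval_add, add_mul]
    exact hp.add hq
  | monomial n a =>
    have h := integrable_rpow_mul_exp_neg_mul_sq (b := 1 / 4) (by norm_num) (s := n)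
      (by have : (0 : ℝ) ≤ n := n.cast_nonneg
          linarith)
    refine (h.const_mul a).congr (Eventually.of_forall fun x => ?_)
    simp only [Polynomial.eval_monomial, Real.rpow_natCast]
    ring

theorem hasDerivAt_polynomial_mul_gauss (q : Polynomial ℝ) (x : ℝ) :
    HasDerivAt (fun x : ℝ => q.eval x * Real.exp (-(1 / 4) * x ^ 2))
      ((raise q).eval x * Real.exp (-(1 / 4) * x ^ 2)) x := by
  have h1 : HasDerivAt (fun x : ℝ => -(1 / 4) * x ^ 2) (-(x / 2)) x := by
    convert! ((hasDerivAt_id x).pow 2).const_mul (-(1 / 4 : ℝ)) using 1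
    simp
    ring
  convert! (q.hasDerivAt x).mul h1.exp using 1
  rw [eval_raise]
  ring

/-- The scalar products of the Hermite polynomials. -/
noncomputable def hermiteInner (n m : ℕ) : ℝ :=
  ∫ x : ℝ, (hermiteP n).eval x * (hermiteP m).eval x * Real.exp (-(1 / 4) * x ^ 2)

theorem hermiteInner_comm (n m : ℕ) : hermiteInner n m = hermiteInner m n := by
  simp only [hermiteInner, mul_comm ((hermiteP n).eval _)]

/-- Integration by parts, since `p_{n+1} exp(-x²/4)` is the derivative of `p_n exp(-x²/4)`. -/
theorem hermiteInner_succ (n m : ℕ) :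
    hermiteInner (n + 1) m =
      -∫ x : ℝ, (hermiteP m).derivative.eval x *
        ((hermiteP n).eval x * Real.exp (-(1 / 4) * x ^ 2)) := by
  have hi : ∀ p q : Polynomial ℝ, Integrable fun x : ℝ =>
      p.eval x * (q.eval x * Real.exp (-(1 / 4) * x ^ 2)) := fun p q => by
    refine (integrable_polynomial_mul_gauss (p * q)).congr (Eventually.of_forall fun x => ?_)
    simp only [Polynomial.eval_mul]
    ring
  have h := integral_mul_deriv_eq_deriv_mul_of_integrable
    (u := fun x => (hermiteP m).eval x) (u' := fun x => (hermiteP m).derivative.eval x)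
    (v := fun x : ℝ => (hermiteP n).eval x * Real.exp (-(1 / 4) * x ^ 2))
    (v' := fun x : ℝ => (hermiteP (n + 1)).eval x * Real.exp (-(1 / 4) * x ^ 2))
    (fun x _ => (hermiteP m).hasDerivAt x) (fun x _ => hasDerivAt_polynomial_mul_gauss _ x)
    (hi _ _) (hi _ _) (hi _ _)
  rw [← h, hermiteInner]
  congr 1
  funext x
  ring

theorem hermiteInner_succ_zero (n : ℕ) : hermiteInner (n + 1) 0 = 0 := by
  rw [hermiteInner_succ]
  simp [hermiteP]

/-- By the lowering relation both indices drop by one, so every scalar product reduces to one with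
an index equal to `0`. -/
theorem hermiteInner_succ_succ (n m : ℕ) :
    hermiteInner (n + 1) (m + 1) = ((m : ℝ) + 1) / 2 * hermiteInner n m := by
  rw [hermiteInner_succ, hermiteInner, ← integral_neg, ← integral_const_mul]
  congr 1
  funext x
  rw [eval_derivative_hermiteP_succ]
  ring

theorem hermiteInner_zero_zero : hermiteInner 0 0 = (4 * Real.pi) ^ (1 / 2 : ℝ) := by
  simp only [hermiteInner, hermiteP, Polynomial.eval_one, one_mul]
  rw [integral_gaussian, Real.sqrt_eq_rpow]
  congr 1
  ring

theorem hermiteInner_self (n : ℕ) :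
    hermiteInner n n = (n.factorial : ℝ) / 2 ^ n * (4 * Real.pi) ^ (1 / 2 : ℝ) := by
  induction n with
  | zero => simp [hermiteInner_zero_zero]
  | succ n ih =>
    rw [hermiteInner_succ_succ, ih, Nat.factorial_succ, pow_succ]
    push_cast
    field_simp

theorem hermiteInner_of_ne {n m : ℕ} (h : n ≠ m) : hermiteInner n m = 0 := by
  induction n generalizing m with
  | zero =>
    cases m with
    | zero => exact absurd rfl h
    | succ m => rw [hermiteInner_comm, hermiteInner_succ_zero]
  | succ n ih =>
    cases m with
    | zero => exact hermiteInner_succ_zero n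
    | succ m => rw [hermiteInner_succ_succ, ih (by omega), mul_zero]

/-! ### The weighted measure -/

theorem weight_pos (N : ℕ) (y : Space N) : 0 < weight N y := Real.exp_pos _

theorem integral_weightMeasure {N : ℕ} (g : Space N → ℝ) :
    ∫ y, g y ∂weightMeasure N = ∫ y, weight N y * g y := by
  rw [weightMeasure, integral_withDensity_eq_integral_toReal_smul (measurable_weight N)
    (Eventually.of_forall fun _ => ENNReal.ofReal_lt_top)]
  simp only [ENNReal.toReal_ofReal (weight_pos N _).le, smul_eq_mul]

theorem integrable_weightMeasure {N : ℕ} {g : Space N → ℝ} :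
    Integrable g (weightMeasure N) ↔ Integrable fun y => weight N y * g y := by
  rw [weightMeasure, integrable_withDensity_iff_integrable_smul' (measurable_weight N)
    (Eventually.of_forall fun _ => ENNReal.ofReal_lt_top)]
  simp only [ENNReal.toReal_ofReal (weight_pos N _).le, smul_eq_mul]

theorem weightMeasure_absolutelyContinuous (N : ℕ) :
    weightMeasure N ≪ (volume : Measure (Space N)) := withDensity_absolutelyContinuous _ _

theorem ae_weightMeasure_iff {N : ℕ} {p : Space N → Prop} :
    (∀ᵐ y ∂weightMeasure N, p y) ↔ ∀ᵐ y, p y :=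
  ⟨fun h => (volume_absolutelyContinuous N).ae_le h,
    fun h => (weightMeasure_absolutelyContinuous N).ae_le h⟩

/-! ### Functions of exponential growth and their pairing with `L²(K)` -/

/-- Continuous functions of at most exponential growth. -/
structure ExpBdd {N : ℕ} (ψ : Space N → ℝ) : Prop where
  continuous : Continuous ψ
  bound : ∃ C a : ℝ, 0 ≤ C ∧ 0 ≤ a ∧ ∀ y, |ψ y| ≤ C * Real.exp (a * ‖y‖)

namespace ExpBdd

variable {N : ℕ} {φ ψ : Space N → ℝ}

theorem mul (hφ : ExpBdd φ) (hψ : ExpBdd ψ) : ExpBdd fun y => φ y * ψ y := by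
  obtain ⟨C, a, hC, ha, h⟩ := hφ.bound
  obtain ⟨D, b, hD, hb, h'⟩ := hψ.bound
  refine ⟨hφ.continuous.mul hψ.continuous, C * D, a + b, by positivity, by positivity, fun y => ?_⟩
  rw [abs_mul, add_mul, Real.exp_add, mul_mul_mul_comm]
  exact mul_le_mul (h y) (h' y) (abs_nonneg _) (by positivity)

theorem add (hφ : ExpBdd φ) (hψ : ExpBdd ψ) : ExpBdd fun y => φ y + ψ y := by
  obtain ⟨C, a, hC, ha, h⟩ := hφ.bound
  obtain ⟨D, b, hD, hb, h'⟩ := hψ.bound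
  refine ⟨hφ.continuous.add hψ.continuous, C + D, a + b, by positivity, by positivity, fun y => ?_⟩
  refine (abs_add_le _ _).trans ?_
  rw [add_mul C]
  refine add_le_add ((h y).trans ?_) ((h' y).trans ?_)
  · gcongr
    linarith
  · gcongr
    linarith

theorem const (c : ℝ) : ExpBdd fun _ : Space N => c :=
  ⟨continuous_const, |c|, 0, abs_nonneg c, le_rfl, fun y => by simp⟩

theorem const_mul (c : ℝ) (hφ : ExpBdd φ) : ExpBdd fun y => c * φ y := (const c).mul hφ

theorem neg (hφ : ExpBdd φ) : ExpBdd fun y => -φ y := by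
  simpa using hφ.const_mul (-1)

theorem pow (hφ : ExpBdd φ) (n : ℕ) : ExpBdd fun y => φ y ^ n := by
  induction n with
  | zero => simpa using const 1
  | succ n ih => simpa [pow_succ] using ih.mul hφ

theorem sum {ι : Type*} (s : Finset ι) {f : ι → Space N → ℝ} (h : ∀ i ∈ s, ExpBdd (f i)) :
    ExpBdd fun y => ∑ i ∈ s, f i y := by
  classical
  induction s using Finset.induction_on with
  | empty => simpa using const 0
  | insert i s hi ih =>
    simp only [Finset.sum_insert hi]
    exact (h i (Finset.mem_insert_self _ _)).add (ih fun j hj => h j (Finset.mem_insert_of_mem hj))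

theorem prod {ι : Type*} (s : Finset ι) {f : ι → Space N → ℝ} (h : ∀ i ∈ s, ExpBdd (f i)) :
    ExpBdd fun y => ∏ i ∈ s, f i y := by
  classical
  induction s using Finset.induction_on with
  | empty => simpa using const 1
  | insert i s hi ih =>
    simp only [Finset.prod_insert hi]
    exact (h i (Finset.mem_insert_self _ _)).mul (ih fun j hj => h j (Finset.mem_insert_of_mem hj))

theorem coord (i : Fin N) : ExpBdd fun y : Space N => y i := by
  refine ⟨by fun_prop, 1, 1, zero_le_one, zero_le_one, fun y => ?_⟩
  have h1 := PiLp.norm_apply_le y i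
  have h2 := Real.add_one_le_exp ‖y‖
  rw [Real.norm_eq_abs] at h1
  simp only [one_mul]
  linarith

theorem polynomial (q : Polynomial ℝ) (i : Fin N) : ExpBdd fun y : Space N => q.eval (y i) := by
  induction q using Polynomial.induction_on' with
  | add p q hp hq => simpa using hp.add hq
  | monomial n a => simpa using ((coord i).pow n).const_mul a

theorem polyTensor (q : Fin N → Polynomial ℝ) : ExpBdd (polyTensor q) :=
  prod _ fun _ _ => polynomial _ _

theorem exp_abs (hφ : ∃ C, 0 ≤ C ∧ ∀ y, |φ y| ≤ C * ‖y‖) (hc : Continuous φ) :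
    ExpBdd fun y => Real.exp |φ y| := by
  obtain ⟨C, hC, h⟩ := hφ
  refine ⟨hc.abs.rexp, 1, C, zero_le_one, hC, fun y => ?_⟩
  rw [Real.abs_exp, one_mul]
  exact Real.exp_le_exp.2 (h y)

theorem of_hasCompactSupport (h1 : Continuous φ) (h2 : HasCompactSupport φ) : ExpBdd φ := by
  obtain ⟨C, hC⟩ := h2.exists_bound_of_continuous h1
  refine ⟨h1, C, 0, (norm_nonneg _).trans (hC 0), le_rfl, fun y => ?_⟩
  simpa using hC y

theorem memLp (hφ : ExpBdd φ) : MemLp (fun y => φ y / weight N y) 2 (weightMeasure N) := by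
  have hw : Continuous (weight N) := by unfold weight; fun_prop
  have hc : Continuous fun y => φ y / weight N y :=
    hφ.continuous.div hw fun y => (weight_pos N y).ne'
  rw [memLp_two_iff_integrable_sq hc.aestronglyMeasurable, integrable_weightMeasure]
  obtain ⟨C, a, hC, ha, h⟩ := hφ.bound
  have hg : Integrable fun y : Space N => Real.exp (-(1 / 8) * ‖y‖ ^ 2) := by
    have h := (GaussianFourier.integrable_cexp_neg_mul_sq_norm_add (V := Space N)
      (b := (1 / 8 : ℂ)) (by norm_num) 0 0).norm
    refine h.congr (Eventually.of_forall fun y => ?_)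
    simp only [Complex.norm_exp, zero_mul, add_zero]
    congr 1
    have : (-(1 / 8 : ℂ) * (‖y‖ : ℂ) ^ 2) = ((-(1 / 8) * ‖y‖ ^ 2 : ℝ) : ℂ) := by push_cast; ring
    rw [this, Complex.ofReal_re]
  -- The constant comes from completing the square: `2 a r - r²/4 ≤ 8 a² - r²/8` is `(r - 8 a)² ≥
  -- 0`.
  refine (hg.const_mul (C ^ 2 * Real.exp (8 * a ^ 2))).mono'
    (hw.mul (hc.pow 2)).aestronglyMeasurable (Eventually.of_forall fun y => ?_)
  have e : weight N y * (φ y / weight N y) ^ 2 = φ y ^ 2 * Real.exp (-(‖y‖ ^ 2 / 4)) := by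
    have := (weight_pos N y).ne'
    rw [Real.exp_neg, show Real.exp (‖y‖ ^ 2 / 4) = weight N y from rfl]
    field_simp
  rw [e, Real.norm_eq_abs, abs_of_nonneg (by positivity), ← sq_abs]
  calc |φ y| ^ 2 * Real.exp (-(‖y‖ ^ 2 / 4))
      ≤ (C * Real.exp (a * ‖y‖)) ^ 2 * Real.exp (-(‖y‖ ^ 2 / 4)) := by
        gcongr
        exact h y
    _ = C ^ 2 * Real.exp (2 * (a * ‖y‖) + -(‖y‖ ^ 2 / 4)) := by
        rw [mul_pow, Real.exp_add, two_mul, Real.exp_add]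
        ring
    _ ≤ C ^ 2 * Real.exp (8 * a ^ 2 + -(1 / 8) * ‖y‖ ^ 2) := by
        refine mul_le_mul_of_nonneg_left (Real.exp_le_exp.2 ?_) (by positivity)
        nlinarith [sq_nonneg (‖y‖ - 8 * a)]
    _ = _ := by rw [Real.exp_add]; ring

/-- The element `ψ / K` of `L²(K)`, which represents the functional `v ↦ ∫ v ψ dy`. -/
noncomputable def dual (hφ : ExpBdd φ) : L2K N := hφ.memLp.toLp _

theorem coeFn_dual (hφ : ExpBdd φ) : ∀ᵐ y, hφ.dual y = φ y / weight N y :=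
  ae_weightMeasure_iff.1 hφ.memLp.coeFn_toLp

/-- The weight cancels. Unweighted pairings thereby become continuous functionals on `L²(K)`, so
distributional identities pass to limits and sums. -/
theorem inner_dual (hφ : ExpBdd φ) (v : L2K N) : inner ℝ hφ.dual v = ∫ y, v y * φ y := by
  rw [L2.inner_def, integral_weightMeasure]
  refine integral_congr_ae ?_
  filter_upwards [hφ.coeFn_dual] with y hy
  rw [hy, RCLike.inner_apply, conj_trivial]
  have := (weight_pos N y).ne'
  field_simp

theorem integrable_mul (hφ : ExpBdd φ) (v : L2K N) : Integrable fun y => v y * φ y := by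
  have h := integrable_weightMeasure.1 (L2.integrable_inner (𝕜 := ℝ) hφ.dual v)
  refine h.congr ?_
  filter_upwards [hφ.coeFn_dual] with y hy
  rw [hy, RCLike.inner_apply, conj_trivial]
  have := (weight_pos N y).ne'
  field_simp

end ExpBdd

/-! ### Completeness of the Hermite polynomials -/

/-- The function `(∏ j, q_j (y_j)) φ₁(y)` as an element of `L²(K)`. -/
noncomputable def gaussL2 {N : ℕ} (q : Fin N → Polynomial ℝ) : L2K N :=
  ((ExpBdd.polyTensor q).const_mul ((4 * Real.pi) ^ (-(N : ℝ) / 4))).dual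

theorem gaussTensor_eq {N : ℕ} (q : Fin N → Polynomial ℝ) (y : Space N) :
    gaussTensor q y = (4 * Real.pi) ^ (-(N : ℝ) / 4) * polyTensor q y / weight N y := by
  rw [gaussTensor, phiOneFun, weight, neg_div (4 : ℝ) (‖y‖ ^ 2), Real.exp_neg]
  ring

theorem coeFn_gaussL2 {N : ℕ} (q : Fin N → Polynomial ℝ) :
    ∀ᵐ y, gaussL2 q y = gaussTensor q y := by
  filter_upwards [((ExpBdd.polyTensor q).const_mul ((4 * Real.pi) ^ (-(N : ℝ) / 4))).coeFn_dual]
    with y hy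
  rw [gaussTensor_eq]
  exact hy

theorem inner_gaussL2 {N : ℕ} (q : Fin N → Polynomial ℝ) (v : L2K N) :
    inner ℝ (gaussL2 q) v = (4 * Real.pi) ^ (-(N : ℝ) / 4) * ∫ y, v y * polyTensor q y := by
  rw [gaussL2, ExpBdd.inner_dual, ← integral_const_mul]
  congr 1
  funext y
  ring

/-- The Hermite polynomials with multi-index `β`. -/
noncomputable def hermiteTensor {N : ℕ} (β : Fin N → ℕ) : Fin N → Polynomial ℝ :=
  fun j => hermiteP (β j)

theorem update_hermiteTensor {N : ℕ} (β : Fin N → ℕ) (i : Fin N) (n : ℕ) :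
    Function.update (hermiteTensor β) i (hermiteP n) = hermiteTensor (Function.update β i n) := by
  funext j
  by_cases h : j = i
  · subst h
    simp [hermiteTensor]
  · simp [hermiteTensor, h]

/-- The linear span of the products of Hermite polynomials. -/
noncomputable def hermiteSpan (N : ℕ) : Submodule ℝ (Space N → ℝ) :=
  Submodule.span ℝ (range fun β : Fin N → ℕ => polyTensor (hermiteTensor β))

/-- The three-term recurrence solved for `x p_n = -2 p_{n+1} - n p_{n-1}`. -/
theorem coord_mul_mem_hermiteSpan {N : ℕ} (i : Fin N) {f : Space N → ℝ} (hf : f ∈ hermiteSpan N) :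
    (fun y => y i * f y) ∈ hermiteSpan N := by
  induction hf using Submodule.span_induction with
  | mem f hf =>
    obtain ⟨β, rfl⟩ := hf
    have key : (fun y => y i * polyTensor (hermiteTensor β) y) =
        (-2 : ℝ) • polyTensor (hermiteTensor (Function.update β i (β i + 1))) +
          (-(β i : ℝ)) • polyTensor (hermiteTensor (Function.update β i (β i - 1))) := by
      funext y
      simp only [Pi.add_apply, Pi.smul_apply, smul_eq_mul]
      rw [← update_hermiteTensor, ← update_hermiteTensor, polyTensor_update, polyTensor_update,
        polyTensor_eq _ i]
      have e : y i * (hermiteP (β i)).eval (y i) = -2 * (hermiteP (β i + 1)).eval (y i) +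
          -(β i : ℝ) * (hermiteP (β i - 1)).eval (y i) := by
        -- For `β i = 0` the truncated index `β i - 1` is harmless, as its coefficient `β i`
        -- vanishes.
        cases h : β i with
        | zero =>
          simp [hermiteP, raise]
        | succ n =>
          have := hermiteP_recurrence n (y i)
          simp only [Nat.add_sub_cancel]
          push_cast
          linarith
      rw [hermiteTensor, ← mul_assoc, e]
      ring
    rw [key]
    exact add_mem (Submodule.smul_mem _ _ (Submodule.subset_span ⟨_, rfl⟩))
      (Submodule.smul_mem _ _ (Submodule.subset_span ⟨_, rfl⟩))
  | zero =>
    simp only [Pi.zero_apply, mul_zero]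
    exact (hermiteSpan N).zero_mem
  | add f g _ _ hf hg => simpa only [Pi.add_apply, mul_add] using! add_mem hf hg
  | smul c f _ hf =>
    have := Submodule.smul_mem _ c hf
    convert! this using 1
    funext y
    simp only [Pi.smul_apply, smul_eq_mul]
    ring

theorem inner_pow_mem_hermiteSpan {N : ℕ} (ξ : Space N) (n : ℕ) :
    (fun y : Space N => (inner ℝ y ξ : ℝ) ^ n) ∈ hermiteSpan N := by
  induction n with
  | zero =>
    refine Submodule.subset_span ⟨0, ?_⟩
    funext y
    simp [polyTensor, hermiteTensor, hermiteP]
  | succ n ih =>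
    have e : (fun y : Space N => (inner ℝ y ξ : ℝ) ^ (n + 1)) =
        ∑ i, ξ i • fun y : Space N => y i * (inner ℝ y ξ : ℝ) ^ n := by
      funext y
      simp only [Finset.sum_apply, Pi.smul_apply, smul_eq_mul]
      rw [pow_succ']
      generalize (inner ℝ y ξ : ℝ) ^ n = k
      rw [PiLp.inner_apply, Finset.sum_mul]
      refine Finset.sum_congr rfl fun i _ => ?_
      rw [RCLike.inner_apply, conj_trivial]
      ring
    rw [e]
    exact sum_mem fun i _ => Submodule.smul_mem _ _ (coord_mul_mem_hermiteSpan i ih)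

theorem integral_mul_hermiteSpan {N : ℕ} {v : L2K N}
    (h : ∀ β : Fin N → ℕ, ∫ y, v y * polyTensor (hermiteTensor β) y = 0) {f : Space N → ℝ}
    (hf : f ∈ hermiteSpan N) : Integrable (fun y => v y * f y) ∧ ∫ y, v y * f y = 0 := by
  induction hf using Submodule.span_induction with
  | mem f hf =>
    obtain ⟨β, rfl⟩ := hf
    exact ⟨(ExpBdd.polyTensor _).integrable_mul v, h β⟩
  | zero => simp
  | add f g _ _ hf hg =>
    simp only [Pi.add_apply, mul_add]
    refine ⟨hf.1.add hg.1, ?_⟩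
    rw [integral_add hf.1 hg.1, hf.2, hg.2, add_zero]
  | smul c f _ hf =>
    simp only [Pi.smul_apply, smul_eq_mul, mul_left_comm _ c]
    refine ⟨hf.1.const_mul c, ?_⟩
    rw [integral_const_mul, hf.2, mul_zero]

/-- Each partial sum of the exponential series is a polynomial in `y · ξ` and pairs to zero with
`v`. All of them are dominated by `|v| exp |y · ξ|`, which is integrable because `K` outgrows the
exponential. -/
theorem integral_mul_cexp_eq_zero {N : ℕ} {v : L2K N}
    (h : ∀ β : Fin N → ℕ, ∫ y, v y * polyTensor (hermiteTensor β) y = 0) (ξ : Space N) :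
    ∫ y : Space N, (v y : ℂ) * Complex.exp ((inner ℝ y ξ : ℝ) * Complex.I) = 0 := by
  have hF : ∀ (k : ℕ) (y : Space N), (v y : ℂ) * (((inner ℝ y ξ : ℝ) * Complex.I) ^ k / k.factorial)
      = (Complex.I ^ k / k.factorial) * ((v y * (inner ℝ y ξ : ℝ) ^ k : ℝ) : ℂ) := fun k y => by
    push_cast
    rw [mul_pow]
    ring
  have hm := fun k => integral_mul_hermiteSpan h (inner_pow_mem_hermiteSpan ξ k)
  have hb : ExpBdd fun y : Space N => Real.exp |(inner ℝ y ξ : ℝ)| := by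
    refine ExpBdd.exp_abs ⟨‖ξ‖, norm_nonneg _, fun y => ?_⟩ (by fun_prop)
    rw [mul_comm]
    exact abs_real_inner_le_norm _ _
  have hlim := tendsto_integral_of_dominated_convergence
    (F := fun n (y : Space N) => ∑ k ∈ Finset.range n,
      (v y : ℂ) * (((inner ℝ y ξ : ℝ) * Complex.I) ^ k / k.factorial))
    (f := fun y => (v y : ℂ) * Complex.exp ((inner ℝ y ξ : ℝ) * Complex.I))
    (μ := volume) (fun y => ‖v y * Real.exp |(inner ℝ y ξ : ℝ)|‖) (fun n => ?_)
    (hb.integrable_mul v).norm (fun n => Eventually.of_forall fun y => ?_)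
    (Eventually.of_forall fun y => ?_)
  · refine tendsto_nhds_unique hlim ?_
    refine tendsto_const_nhds.congr fun n => ?_
    rw [eq_comm, integral_finsetSum]
    · apply Finset.sum_eq_zero
      intro k _
      simp only [hF]
      rw [integral_const_mul, integral_complex_ofReal, (hm k).2]
      simp
    · intro k _
      simp only [hF]
      exact (hm k).1.ofReal.const_mul _
  · refine Finset.aestronglyMeasurable_fun_sum _ fun k _ => ?_
    simp only [hF]
    exact ((hm k).1.ofReal.const_mul _).aestronglyMeasurable
  · rw [← Finset.mul_sum, norm_mul, norm_mul, Complex.norm_real, Real.norm_eq_abs (Real.exp _),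
      Real.abs_exp]
    refine mul_le_mul_of_nonneg_left ?_ (norm_nonneg _)
    refine (norm_sum_le _ _).trans (le_trans (le_of_eq ?_) (Real.sum_le_exp_of_nonneg
      (abs_nonneg (inner ℝ y ξ : ℝ)) n))
    refine Finset.sum_congr rfl fun k _ => ?_
    rw [norm_div, norm_pow, norm_mul, Complex.norm_real, Complex.norm_I, mul_one,
      Complex.norm_natCast, Real.norm_eq_abs]
  · simp only [← Finset.mul_sum]
    refine Tendsto.const_mul _ ?_
    rw [Complex.exp_eq_exp_ℂ]
    exact (NormedSpace.expSeries_div_hasSum_exp _).tendsto_sum_nat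

/-- Injectivity of the Fourier transform on real `L¹` functions: the positive and negative parts of
`v` are densities of two finite measures with the same characteristic function, so the measures and
their densities agree. -/
theorem ae_eq_zero_of_integral_mul_cexp {E : Type*} [NormedAddCommGroup E]
    [InnerProductSpace ℝ E] [CompleteSpace E] [SecondCountableTopology E] [MeasurableSpace E]
    [BorelSpace E] {μ : Measure E} {v : E → ℝ} (hv : Integrable v μ)
    (h : ∀ ξ, ∫ y, (v y : ℂ) * Complex.exp ((inner ℝ y ξ : ℝ) * Complex.I) ∂μ = 0) :
    v =ᵐ[μ] 0 := by
  have hm : ∀ {f : E → ℝ}, Integrable f μ → AEMeasurable (fun x => ENNReal.ofReal (f x)) μ :=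
    fun hf => hf.aestronglyMeasurable.aemeasurable.ennreal_ofReal
  have := isFiniteMeasure_withDensity_ofReal hv.2
  have := isFiniteMeasure_withDensity_ofReal hv.neg.2
  have hexp : ∀ (f : E → ℝ) (ξ : E), Integrable f μ →
      Integrable (fun y => (f y : ℂ) * Complex.exp ((inner ℝ y ξ : ℝ) * Complex.I)) μ := by
    intro f ξ hf
    refine hf.ofReal.mul_bdd (c := 1) ?_ (Eventually.of_forall fun y => ?_)
    · exact (by fun_prop : Continuous fun y : E =>
        Complex.exp ((inner ℝ y ξ : ℝ) * Complex.I)).aestronglyMeasurable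
    · rw [Complex.norm_exp_ofReal_mul_I]
  have hchar : ∀ (f : E → ℝ) (ξ : E), Integrable f μ →
      charFun (μ.withDensity fun x => ENNReal.ofReal (f x)) ξ =
        ∫ y, ((max (f y) 0 : ℝ) : ℂ) * Complex.exp ((inner ℝ y ξ : ℝ) * Complex.I) ∂μ := by
    intro f ξ hf
    rw [charFun_apply, integral_withDensity_eq_integral_toReal_smul₀ (hm hf)
      (Eventually.of_forall fun _ => ENNReal.ofReal_lt_top)]
    simp only [ENNReal.toReal_ofReal', Complex.real_smul]
  have heq : (μ.withDensity fun x => ENNReal.ofReal (v x)) =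
      μ.withDensity fun x => ENNReal.ofReal ((-v) x) := by
    refine Measure.ext_of_charFun (funext fun ξ => ?_)
    rw [hchar v ξ hv, hchar (-v) ξ hv.neg, ← sub_eq_zero,
      ← integral_sub (hexp _ ξ hv.pos_part) (hexp _ ξ hv.neg.pos_part), ← h ξ]
    congr 1
    funext y
    rw [← sub_mul, ← Complex.ofReal_sub]
    congr 2
    simp only [Pi.neg_apply]
    rcases le_total 0 (v y) with h0 | h0
    · rw [max_eq_left h0, max_eq_right (by linarith), sub_zero]
    · rw [max_eq_right h0, max_eq_left (by linarith)]
      ring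
  rw [withDensity_eq_iff (hm hv) (hm hv.neg)] at heq
  · filter_upwards [heq] with y hy
    simp only [Pi.neg_apply, Pi.zero_apply] at hy ⊢
    rcases lt_trichotomy (v y) 0 with h0 | h0 | h0
    · rw [ENNReal.ofReal_of_nonpos h0.le, eq_comm, ENNReal.ofReal_eq_zero] at hy
      linarith
    · exact h0
    · rw [ENNReal.ofReal_of_nonpos (p := -v y) (by linarith), ENNReal.ofReal_eq_zero] at hy
      linarith
  · exact hv.lintegral_lt_top.ne

theorem eq_zero_of_integral_mul_hermiteTensor {N : ℕ} {v : L2K N}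
    (h : ∀ β : Fin N → ℕ, ∫ y, v y * polyTensor (hermiteTensor β) y = 0) : v = 0 := by
  have hv : Integrable (v : Space N → ℝ) := by
    simpa using (ExpBdd.const (N := N) 1).integrable_mul v
  have h0 := ae_eq_zero_of_integral_mul_cexp hv (integral_mul_cexp_eq_zero h)
  rw [Lp.eq_zero_iff_ae_eq_zero]
  exact ae_weightMeasure_iff.2 h0

/-! ### Orthogonality and the Hilbert basis -/

/-- `1 / K` is a product of one-dimensional Gaussians, so Fubini reduces the scalar products to
dimension one. -/
theorem integral_polyTensor_mul_gauss {N : ℕ} (q : Fin N → Polynomial ℝ) :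
    ∫ y : Space N, polyTensor q y / weight N y =
      ∏ j, ∫ x : ℝ, (q j).eval x * Real.exp (-(1 / 4) * x ^ 2) := by
  rw [← integral_fintype_prod_volume_eq_prod (f := fun j (x : ℝ) =>
    (q j).eval x * Real.exp (-(1 / 4) * x ^ 2)),
    ← (EuclideanSpace.volume_preserving_symm_measurableEquiv_toLp (Fin N)).integral_comp
      (MeasurableEquiv.measurableEmbedding _)]
  congr 1
  funext y
  rw [Finset.prod_mul_distrib, ← Real.exp_sum, ← Finset.mul_sum, weight, EuclideanSpace.norm_sq_eq,
    div_eq_mul_inv, ← Real.exp_neg, polyTensor]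
  congr 2
  simp
  ring

/-- The squared norm `∏ j, β_j! / 2^{β_j}` of the derivative `D^β φ₁` in `L²(K)`. -/
noncomputable def hermiteNormSq {N : ℕ} (β : Fin N → ℕ) : ℝ :=
  ∏ j, ((β j).factorial : ℝ) / 2 ^ β j

theorem hermiteNormSq_pos {N : ℕ} (β : Fin N → ℕ) : 0 < hermiteNormSq β :=
  Finset.prod_pos fun _ _ => by positivity

theorem inner_gaussL2_hermiteTensor {N : ℕ} (β γ : Fin N → ℕ) :
    inner ℝ (gaussL2 (hermiteTensor β)) (gaussL2 (hermiteTensor γ)) =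
      if β = γ then hermiteNormSq β else 0 := by
  have h1 : inner ℝ (gaussL2 (hermiteTensor β)) (gaussL2 (hermiteTensor γ)) =
      ((4 * Real.pi) ^ (-(N : ℝ) / 4)) ^ 2 * ∏ j, hermiteInner (β j) (γ j) := by
    have h2 : ∏ j, hermiteInner (β j) (γ j) = ∫ y : Space N,
        polyTensor (fun j => hermiteP (β j) * hermiteP (γ j)) y / weight N y := by
      rw [integral_polyTensor_mul_gauss]
      simp only [hermiteInner, Polynomial.eval_mul]
    rw [inner_gaussL2, h2, sq, mul_assoc]
    congr 1
    rw [← integral_const_mul]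
    refine integral_congr_ae ?_
    filter_upwards [coeFn_gaussL2 (hermiteTensor γ)] with y hy
    rw [hy, gaussTensor_eq]
    simp only [polyTensor, hermiteTensor, Polynomial.eval_mul, Finset.prod_mul_distrib]
    ring
  rw [h1]
  split_ifs with h
  · subst h
    simp only [hermiteInner_self, Finset.prod_mul_distrib, Finset.prod_const, Finset.card_univ,
      Fintype.card_fin]
    have h4 : (0 : ℝ) < 4 * Real.pi := by positivity
    -- The normalisation of `φ₁` cancels the `N` one-dimensional Gaussian integrals.
    have : ((4 * Real.pi) ^ (-(N : ℝ) / 4)) ^ 2 * ((4 * Real.pi) ^ (1 / 2 : ℝ)) ^ N = 1 := by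
      rw [← Real.rpow_natCast, ← Real.rpow_natCast, ← Real.rpow_mul h4.le, ← Real.rpow_mul h4.le,
        ← Real.rpow_add h4]
      convert! Real.rpow_zero _ using 2
      push_cast
      ring
    rw [mul_left_comm, this, mul_one, hermiteNormSq]
  · obtain ⟨j, hj⟩ := Function.ne_iff.1 h
    rw [Finset.prod_eq_zero (Finset.mem_univ j) (hermiteInner_of_ne hj), mul_zero]

/-- The normalised Hermite functions. -/
noncomputable def hermiteE {N : ℕ} (β : Fin N → ℕ) : L2K N :=
  (√(hermiteNormSq β))⁻¹ • gaussL2 (hermiteTensor β)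

theorem gaussL2_hermiteTensor {N : ℕ} (β : Fin N → ℕ) :
    gaussL2 (hermiteTensor β) = √(hermiteNormSq β) • hermiteE β := by
  rw [hermiteE, smul_smul, mul_inv_cancel₀ (Real.sqrt_pos.2 (hermiteNormSq_pos β)).ne', one_smul]

theorem orthonormal_hermiteE (N : ℕ) : Orthonormal ℝ (hermiteE (N := N)) := by
  classical
  rw [orthonormal_iff_ite]
  intro β γ
  rw [hermiteE, hermiteE, real_inner_smul_left, real_inner_smul_right, inner_gaussL2_hermiteTensor]
  split_ifs with h
  · subst h
    have h1 := Real.mul_self_sqrt (hermiteNormSq_pos β).le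
    have h2 := (Real.sqrt_pos.2 (hermiteNormSq_pos β)).ne'
    rw [← mul_assoc, ← mul_inv, h1, inv_mul_cancel₀ (hermiteNormSq_pos β).ne']
  · simp

/-- The Hilbert basis of `L²(K)` formed by the normalised Hermite functions. -/
noncomputable def hermiteBasis (N : ℕ) : HilbertBasis (Fin N → ℕ) ℝ (L2K N) :=
  HilbertBasis.mkOfOrthogonalEqBot (orthonormal_hermiteE N) <| by
    rw [Submodule.eq_bot_iff]
    intro v hv
    refine eq_zero_of_integral_mul_hermiteTensor fun β => ?_
    have h1 : inner ℝ (gaussL2 (hermiteTensor β)) v = 0 := by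
      rw [gaussL2_hermiteTensor, real_inner_smul_left,
        (Submodule.mem_orthogonal _ _).1 hv _ (Submodule.subset_span ⟨β, rfl⟩), mul_zero]
    rw [inner_gaussL2] at h1
    exact (mul_eq_zero.1 h1).resolve_left (by positivity)

theorem hermiteBasis_apply {N : ℕ} (β : Fin N → ℕ) : hermiteBasis N β = hermiteE β := by
  rw [hermiteBasis, HilbertBasis.coe_mkOfOrthogonalEqBot]

theorem hermiteE_zero (N : ℕ) : hermiteE (0 : Fin N → ℕ) = phiOne N := by
  rw [hermiteE, hermiteNormSq]
  simp only [Pi.zero_apply, Nat.factorial_zero, pow_zero, Nat.cast_one, div_one, Finset.prod_const_one,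
    Real.sqrt_one, inv_one, one_smul]
  refine Lp.ext (ae_weightMeasure_iff.2 ?_)
  filter_upwards [coeFn_gaussL2 (hermiteTensor (0 : Fin N → ℕ)),
    ae_weightMeasure_iff.1 (memLp_phiOneFun N).coeFn_toLp] with y h1 h2
  rw [h1, phiOne, h2]
  simp [gaussTensor, polyTensor, hermiteTensor, hermiteP]

/-! ### Partial derivatives and multi-indices -/

theorem foldr_partialD_single {N : ℕ} (i : Fin N) (k : ℕ) (φ : Space N → ℝ) (l : List (Fin N))
    (hl : l.Nodup) :
    l.foldr (fun j ψ => (partialD j)^[(Pi.single i k : Fin N → ℕ) j] ψ) φ =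
      if i ∈ l then (partialD i)^[k] φ else φ := by
  induction l with
  | nil => simp
  | cons j l ih =>
    rw [List.nodup_cons] at hl
    rw [List.foldr_cons, ih hl.2]
    by_cases h : j = i
    · subst h
      simp [hl.1]
    · simp [Ne.symm h]

theorem multiD_single {N : ℕ} (i : Fin N) (k : ℕ) (φ : Space N → ℝ) :
    multiD (Pi.single i k) φ = (partialD i)^[k] φ := by
  rw [multiD, foldr_partialD_single i k φ _ (List.nodup_finRange N), if_pos (List.mem_finRange i)]

theorem multiD_single_one {N : ℕ} (i : Fin N) (φ : Space N → ℝ) :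
    multiD (Pi.single i 1) φ = partialD i φ := multiD_single i 1 φ

theorem multiD_single_two {N : ℕ} (i : Fin N) (φ : Space N → ℝ) :
    multiD (Pi.single i 2) φ = partialD i (partialD i φ) := multiD_single i 2 φ

theorem sum_single {N : ℕ} (i : Fin N) (k : ℕ) : ∑ j, (Pi.single i k : Fin N → ℕ) j = k :=
  Finset.sum_pi_single' i k Finset.univ |>.trans (by simp)

theorem ExpBdd.of_test {N : ℕ} {φ : Space N → ℝ} (h : ContDiff ℝ ∞ φ ∧ HasCompactSupport φ) :
    ExpBdd φ := .of_hasCompactSupport h.1.continuous h.2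

theorem contDiff_partialD {N : ℕ} (i : Fin N) {φ : Space N → ℝ} (h : ContDiff ℝ ∞ φ) :
    ContDiff ℝ ∞ (partialD i φ) :=
  (h.fderiv_right (m := ∞) (by simp)).clm_apply contDiff_const

theorem integral_mul_partialD {N : ℕ} (i : Fin N) {f φ : Space N → ℝ} (hf : ContDiff ℝ ∞ f)
    (h : ContDiff ℝ ∞ φ ∧ HasCompactSupport φ) :
    ∫ y, f y * partialD i φ y = -∫ y, partialD i f y * φ y := by
  have hi : ∀ {a b : Space N → ℝ}, ContDiff ℝ ∞ a → ContDiff ℝ ∞ b ∧ HasCompactSupport b →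
      Integrable fun y => a y * b y := fun ha hb =>
    (ha.continuous.mul hb.1.continuous).integrable_of_hasCompactSupport hb.2.mul_left
  exact integral_mul_fderiv_eq_neg_fderiv_mul_of_integrable
    (hi (contDiff_partialD i hf) h) (hi hf (partialD_smooth i h)) (hi hf h)
    (fun y _ => hf.differentiable (by simp) y) (fun y _ => h.1.differentiable (by simp) y)

/-! ### Weak derivatives of the Hermite functions -/

theorem partialD_gaussTensor_hermiteTensor {N : ℕ} (i : Fin N) (β : Fin N → ℕ) :
    partialD i (gaussTensor (hermiteTensor β)) =
      gaussTensor (hermiteTensor (β + Pi.single i 1)) := by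
  rw [partialD_gaussTensor, show raise (hermiteTensor β i) = hermiteP (β i + 1) from rfl,
    update_hermiteTensor]
  congr 2
  funext j
  by_cases h : j = i
  · subst h
    simp
  · simp [h]

theorem integral_gaussTensor_mul_iterate_partialD {N : ℕ} (i : Fin N) (k : ℕ) (β : Fin N → ℕ)
    {φ : Space N → ℝ} (h : ContDiff ℝ ∞ φ ∧ HasCompactSupport φ) :
    ∫ y, gaussTensor (hermiteTensor β) y * (partialD i)^[k] φ y =
      (-1) ^ k * ∫ y, gaussTensor (hermiteTensor (β + Pi.single i k)) y * φ y := by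
  induction k generalizing φ with
  | zero => simp
  | succ k ih =>
    rw [Function.iterate_succ_apply, ih (partialD_smooth i h),
      integral_mul_partialD i (contDiff_gaussTensor _) h, partialD_gaussTensor_hermiteTensor,
      add_assoc, ← Pi.single_add, pow_succ]
    ring

theorem iterate_partialD_smooth {N : ℕ} (i : Fin N) (k : ℕ) {φ : Space N → ℝ}
    (h : ContDiff ℝ ∞ φ ∧ HasCompactSupport φ) :
    ContDiff ℝ ∞ ((partialD i)^[k] φ) ∧ HasCompactSupport ((partialD i)^[k] φ) := by
  rw [← multiD_single]
  exact multiD_smooth _ h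

/-- `multiD` is a fold over the coordinates, so the integration by parts is an induction on a list.
The multi-index `β` must vary, since each coordinate already treated has shifted it. -/
theorem integral_gaussTensor_mul_foldr {N : ℕ} (α : Fin N → ℕ) (l : List (Fin N))
    (β : Fin N → ℕ) {φ : Space N → ℝ} (h : ContDiff ℝ ∞ φ ∧ HasCompactSupport φ) :
    (ContDiff ℝ ∞ (l.foldr (fun i ψ => (partialD i)^[α i] ψ) φ) ∧
      HasCompactSupport (l.foldr (fun i ψ => (partialD i)^[α i] ψ) φ)) ∧
    ∫ y, gaussTensor (hermiteTensor β) y * l.foldr (fun i ψ => (partialD i)^[α i] ψ) φ y =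
      (-1) ^ (l.map α).sum * ∫ y, gaussTensor
        (hermiteTensor (β + (l.map fun i => Pi.single i (α i)).sum)) y * φ y := by
  induction l generalizing β with
  | nil => simpa using h
  | cons i l ih =>
    simp only [List.foldr_cons, List.map_cons, List.sum_cons]
    refine ⟨iterate_partialD_smooth i _ (ih β).1, ?_⟩
    rw [integral_gaussTensor_mul_iterate_partialD i _ _ (ih β).1, (ih _).2, pow_add, add_assoc,
      mul_assoc]

theorem hasWeakDeriv_gaussL2 {N : ℕ} (α β : Fin N → ℕ) :
    HasWeakDeriv α (gaussL2 (hermiteTensor β)) (gaussL2 (hermiteTensor (β + α))) := by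
  intro φ h1 h2
  have hc : ∀ (γ : Fin N → ℕ) (ψ : Space N → ℝ), ∫ y, gaussL2 (hermiteTensor γ) y * ψ y =
      ∫ y, gaussTensor (hermiteTensor γ) y * ψ y := fun γ ψ => by
    refine integral_congr_ae ?_
    filter_upwards [coeFn_gaussL2 (hermiteTensor γ)] with y hy
    rw [hy]
  rw [hc, hc, multiD, (integral_gaussTensor_mul_foldr α _ β ⟨h1, h2⟩).2, ← List.ofFn_eq_map,
    ← List.ofFn_eq_map, List.sum_ofFn, List.sum_ofFn, Finset.univ_sum_single]

/-- The factor in `D^α e_β = κ e_{β + α}`. -/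
noncomputable def shiftFactor {N : ℕ} (α β : Fin N → ℕ) : ℝ :=
  √(hermiteNormSq (β + α)) / √(hermiteNormSq β)

theorem hasWeakDeriv_hermiteE {N : ℕ} (α β : Fin N → ℕ) :
    HasWeakDeriv α (hermiteE β) (shiftFactor α β • hermiteE (β + α)) := by
  have h := (hasWeakDeriv_gaussL2 α β).smul (√(hermiteNormSq β))⁻¹
  rw [gaussL2_hermiteTensor (β + α), smul_smul] at h
  rwa [shiftFactor, div_eq_inv_mul, hermiteE]

/-! ### Weak derivatives and limits -/

theorem hasWeakDeriv_iff {N : ℕ} {α : Fin N → ℕ} {v w : L2K N} :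
    HasWeakDeriv α v w ↔ ∀ (φ : Space N → ℝ) (h : ContDiff ℝ ∞ φ ∧ HasCompactSupport φ),
      inner ℝ (ExpBdd.of_test (multiD_smooth α h)).dual v =
        (-1 : ℝ) ^ (∑ i, α i) * inner ℝ (ExpBdd.of_test h).dual w := by
  simp only [ExpBdd.inner_dual]
  exact ⟨fun h φ hφ => h φ hφ.1 hφ.2, fun h φ h1 h2 => h φ ⟨h1, h2⟩⟩

/-- Weak differentiation is a closed operator: both sides are scalar products with fixed elements of
`L²(K)`. -/
theorem HasWeakDeriv.of_tendsto {N : ℕ} {α : Fin N → ℕ} {ι : Type*} {l : Filter ι} [l.NeBot]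
    {v w : ι → L2K N} {v₀ w₀ : L2K N} (h : ∀ n, HasWeakDeriv α (v n) (w n))
    (hv : Tendsto v l (𝓝 v₀)) (hw : Tendsto w l (𝓝 w₀)) : HasWeakDeriv α v₀ w₀ := by
  rw [hasWeakDeriv_iff]
  intro φ hφ
  refine tendsto_nhds_unique (tendsto_const_nhds.inner hv)
    (((tendsto_const_nhds.inner hw).const_mul _).congr fun n => ?_)
  exact (hasWeakDeriv_iff.1 (h n) φ hφ).symm

theorem HasWeakDeriv.sum {N : ℕ} {α : Fin N → ℕ} {ι : Type*} (s : Finset ι) {v w : ι → L2K N}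
    (h : ∀ n, HasWeakDeriv α (v n) (w n)) : HasWeakDeriv α (∑ n ∈ s, v n) (∑ n ∈ s, w n) := by
  classical
  induction s using Finset.induction_on with
  | empty => simpa using HasWeakDeriv.zero
  | insert i s hi ih =>
    rw [Finset.sum_insert hi, Finset.sum_insert hi]
    exact (h i).add ih

theorem HasWeakDeriv.of_hasSum {N : ℕ} {α : Fin N → ℕ} {ι : Type*} {v w : ι → L2K N}
    {v₀ w₀ : L2K N} (h : ∀ n, HasWeakDeriv α (v n) (w n)) (hv : HasSum v v₀) (hw : HasSum w w₀) :
    HasWeakDeriv α v₀ w₀ :=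
  .of_tendsto (fun s => .sum s h) hv hw

/-! ### The formal adjoint of `L` -/

/-- The formal adjoint `φ ↦ -Δ φ + div (y φ) / 2` of `L` with respect to `dy`. -/
noncomputable def adjointL {N : ℕ} (φ : Space N → ℝ) (y : Space N) : ℝ :=
  -(Δ φ) y + (N * φ y + fderiv ℝ φ y y) / 2

theorem laplacian_eq_sum_partialD {N : ℕ} {φ : Space N → ℝ} (h : ContDiff ℝ ∞ φ) (y : Space N) :
    (Δ φ) y = ∑ i, partialD i (partialD i φ) y := by
  rw [InnerProductSpace.laplacian_eq_iteratedFDeriv_orthonormalBasis φ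
    (EuclideanSpace.basisFun (Fin N) ℝ)]
  refine Finset.sum_congr rfl fun i _ => ?_
  rw [iteratedFDeriv_two_apply]
  have hd : DifferentiableAt ℝ (fderiv ℝ φ) y :=
    (h.fderiv_right (m := ∞) (by simp)).differentiable (by simp) y
  have := (hd.hasFDerivAt.clm_apply
    (hasFDerivAt_const (EuclideanSpace.single i (1 : ℝ)) y)).fderiv
  rw [partialD, show partialD i φ = fun y => fderiv ℝ φ y (EuclideanSpace.single i 1) from rfl, this]
  simp

theorem adjointL_eq {N : ℕ} {φ : Space N → ℝ} (h : ContDiff ℝ ∞ φ) (y : Space N) :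
    adjointL φ y = ∑ i, (-partialD i (partialD i φ) y + (φ y + y i * partialD i φ y) / 2) := by
  rw [adjointL, laplacian_eq_sum_partialD h, fderiv_apply_eq_sum, Finset.sum_add_distrib,
    ← Finset.sum_div, Finset.sum_add_distrib, Finset.sum_neg_distrib]
  simp

/-- `L u = f` in the sense of distributions. -/
def WeakL {N : ℕ} (u f : L2K N) : Prop :=
  ∀ φ : Space N → ℝ, ContDiff ℝ ∞ φ → HasCompactSupport φ →
    ∫ y, u y * adjointL φ y = ∫ y, f y * φ y

theorem ExpBdd.adjointL {N : ℕ} {φ : Space N → ℝ} (h : ContDiff ℝ ∞ φ) (h0 : ExpBdd φ)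
    (h1 : ∀ i, ExpBdd (partialD i φ)) (h2 : ∀ i, ExpBdd (partialD i (partialD i φ))) :
    ExpBdd (adjointL φ) := by
  rw [show SimilarityHeat.adjointL φ = fun y => ∑ i, (-partialD i (partialD i φ) y +
    1 / 2 * (φ y + y i * partialD i φ y)) from funext fun y => by
      rw [adjointL_eq h]
      exact Finset.sum_congr rfl fun i _ => by ring]
  exact .sum _ fun i _ => (h2 i).neg.add ((h0.add ((ExpBdd.coord i).mul (h1 i))).const_mul _)

theorem ExpBdd.adjointL_of_test {N : ℕ} {φ : Space N → ℝ}
    (h : ContDiff ℝ ∞ φ ∧ HasCompactSupport φ) : ExpBdd (SimilarityHeat.adjointL φ) :=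
  .adjointL h.1 (.of_test h) (fun i => .of_test (partialD_smooth i h))
    fun i => .of_test (partialD_smooth i (partialD_smooth i h))

theorem partialD_coord_mul {N : ℕ} (i : Fin N) {φ : Space N → ℝ} (h : ContDiff ℝ ∞ φ)
    (y : Space N) : partialD i (fun y => y i * φ y) y = φ y + y i * partialD i φ y := by
  have hc : ContDiff ℝ ∞ fun y : Space N => y i := contDiff_piLp_apply (p := 2)
  have h1 : partialD i (fun y : Space N => y i) y = 1 := by
    rw [partialD, show (fun y : Space N => y i) = (EuclideanSpace.proj i : Space N →L[ℝ] ℝ) from rfl,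
      ContinuousLinearMap.fderiv]
    simp
  rw [partialD_mul i hc h]
  simp only [h1, one_mul]

theorem coord_mul_smooth {N : ℕ} (i : Fin N) {φ : Space N → ℝ}
    (h : ContDiff ℝ ∞ φ ∧ HasCompactSupport φ) :
    ContDiff ℝ ∞ (fun y : Space N => y i * φ y) ∧ HasCompactSupport fun y : Space N => y i * φ y :=
  ⟨(contDiff_piLp_apply (p := 2)).mul h.1, h.2.mul_left⟩

/-- The drift term uses the first weak derivative with the test function `y_i φ`, because `∂_i (y_i
φ) = φ + y_i ∂_i φ`. -/
theorem integral_mul_adjointL {N : ℕ} {u : L2K N} {g h : Fin N → L2K N}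
    (hg : ∀ i, HasWeakDeriv (Pi.single i 1) u (g i))
    (hh : ∀ i, HasWeakDeriv (Pi.single i 2) u (h i)) {φ : Space N → ℝ}
    (hφ : ContDiff ℝ ∞ φ ∧ HasCompactSupport φ) :
    Integrable (fun y => (-(∑ i, h i y) - (∑ i, y i * g i y) / 2) * φ y) ∧
    ∫ y, u y * adjointL φ y = ∫ y, (-(∑ i, h i y) - (∑ i, y i * g i y) / 2) * φ y := by
  have hint : ∀ i, Integrable fun y => -(h i y * φ y) - g i y * (y i * φ y) / 2 := fun i =>
    (integrable_mul_test (h i) hφ.1 hφ.2).neg.sub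
    ((integrable_mul_test (g i) (coord_mul_smooth i hφ).1 (coord_mul_smooth i hφ).2).div_const 2)
  have e2 : (fun y => (-(∑ i, h i y) - (∑ i, y i * g i y) / 2) * φ y) =
      fun y => ∑ i, (-(h i y * φ y) - g i y * (y i * φ y) / 2) := by
    funext y
    rw [Finset.sum_sub_distrib, Finset.sum_neg_distrib, ← Finset.sum_div, sub_mul, neg_mul,
      Finset.sum_mul, div_mul_eq_mul_div, Finset.sum_mul]
    congr 2
    exact Finset.sum_congr rfl fun i _ => by ring
  have e1 : (fun y => u y * adjointL φ y) = fun y => ∑ i,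
      (-(u y * partialD i (partialD i φ) y) + u y * partialD i (fun y => y i * φ y) y / 2) := by
    funext y
    rw [adjointL_eq hφ.1, Finset.mul_sum]
    refine Finset.sum_congr rfl fun i _ => ?_
    rw [partialD_coord_mul i hφ.1]
    ring
  have hi1 : ∀ i, Integrable fun y => u y * partialD i (partialD i φ) y := fun i =>
    integrable_mul_test u (partialD_smooth i (partialD_smooth i hφ)).1
      (partialD_smooth i (partialD_smooth i hφ)).2
  have hi2 : ∀ i, Integrable fun y => u y * partialD i (fun y => y i * φ y) y := fun i =>
    integrable_mul_test u (partialD_smooth i (coord_mul_smooth i hφ)).1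
      (partialD_smooth i (coord_mul_smooth i hφ)).2
  have hi3 : ∀ i, Integrable fun y => -(u y * partialD i (partialD i φ) y) +
      u y * partialD i (fun y => y i * φ y) y / 2 := fun i => (hi1 i).neg.add ((hi2 i).div_const 2)
  refine ⟨by rw [e2]; exact integrable_finsetSum _ fun i _ => hint i, ?_⟩
  rw [e1, e2, integral_finsetSum _ fun i _ => hi3 i,
    integral_finsetSum _ fun i _ => hint i]
  refine Finset.sum_congr rfl fun i _ => ?_
  have hh' := hh i φ hφ.1 hφ.2
  have hg' := hg i _ (coord_mul_smooth i hφ).1 (coord_mul_smooth i hφ).2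
  rw [multiD_single_two, sum_single] at hh'
  rw [multiD_single_one, sum_single] at hg'
  have a1 := integral_add (hi1 i).neg ((hi2 i).div_const 2)
  have a2 := integral_sub (integrable_mul_test (h i) hφ.1 hφ.2).neg
    ((integrable_mul_test (g i) (coord_mul_smooth i hφ).1 (coord_mul_smooth i hφ).2).div_const 2)
  simp only [Pi.neg_apply] at a1 a2
  rw [a1, a2, integral_neg, integral_neg, integral_div, integral_div, hh', hg']
  ring

theorem IsL.weakL {N : ℕ} {u f : L2K N} (h : IsL u f) : WeakL u f := by
  obtain ⟨-, g, k, hg, hk, hf⟩ := h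
  intro φ h1 h2
  rw [(integral_mul_adjointL hg hk ⟨h1, h2⟩).2]
  refine integral_congr_ae ?_
  filter_upwards [hf] with y hy
  rw [hy]

/-- The fundamental lemma of the calculus of variations: once the weak derivatives are known to lie
in `L²(K)`, the distributional equation holds almost everywhere. -/
theorem WeakL.ae_eq {N : ℕ} {u f : L2K N} (hw : WeakL u f) {g h : Fin N → L2K N}
    (hg : ∀ i, HasWeakDeriv (Pi.single i 1) u (g i))
    (hh : ∀ i, HasWeakDeriv (Pi.single i 2) u (h i)) :
    ∀ᵐ y, f y = -(∑ i, h i y) - (∑ i, y i * g i y) / 2 := by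
  have hl : ∀ v : L2K N, LocallyIntegrable (v : Space N → ℝ) := fun v =>
    Integrable.locallyIntegrable (by simpa using (ExpBdd.const (N := N) 1).integrable_mul v)
  have hl' : ∀ (i : Fin N) (v : L2K N), LocallyIntegrable fun y : Space N => y i * v y :=
    fun i v => Integrable.locallyIntegrable
      (by simpa only [mul_comm] using (ExpBdd.coord i).integrable_mul v)
  have hs : ∀ {F : Fin N → Space N → ℝ}, (∀ i, LocallyIntegrable (F i)) →
      LocallyIntegrable fun y => ∑ i, F i y := fun h => by
    have := locallyIntegrable_finsetSum Finset.univ fun i _ => h i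
    simpa using this
  refine ae_eq_of_integral_contDiff_smul_eq (hl f) ?_ fun φ h1 h2 => ?_
  · refine (hs fun i => hl (h i)).neg.sub ?_
    simp only [div_eq_mul_inv, mul_comm _ (2 : ℝ)⁻¹]
    exact (hs fun i => hl' i (g i)).smul (2 : ℝ)⁻¹
  · simp only [smul_eq_mul, mul_comm (φ _)]
    rw [← (integral_mul_adjointL hg hh ⟨h1, h2⟩).2, hw φ h1 h2]

theorem weakL_iff {N : ℕ} {u f : L2K N} :
    WeakL u f ↔ ∀ (φ : Space N → ℝ) (h : ContDiff ℝ ∞ φ ∧ HasCompactSupport φ),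
      inner ℝ (ExpBdd.adjointL_of_test h).dual u = inner ℝ (ExpBdd.of_test h).dual f := by
  simp only [ExpBdd.inner_dual]
  exact ⟨fun h φ hφ => h φ hφ.1 hφ.2, fun h φ h1 h2 => h φ ⟨h1, h2⟩⟩

theorem WeakL.smul {N : ℕ} {u f : L2K N} (c : ℝ) (h : WeakL u f) : WeakL (c • u) (c • f) := by
  rw [weakL_iff] at *
  intro φ hφ
  rw [real_inner_smul_right, real_inner_smul_right, h φ hφ]

theorem WeakL.of_hasSum {N : ℕ} {ι : Type*} {u f : ι → L2K N} {u₀ f₀ : L2K N}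
    (h : ∀ n, WeakL (u n) (f n)) (hu : HasSum u u₀) (hf : HasSum f f₀) : WeakL u₀ f₀ := by
  rw [weakL_iff]
  intro φ hφ
  have h1 := hu.mapL (innerSL ℝ (ExpBdd.adjointL_of_test hφ).dual)
  have h2 := hf.mapL (innerSL ℝ (ExpBdd.of_test hφ).dual)
  simp only [innerSL_apply_apply] at h1 h2
  simp only [fun n => weakL_iff.1 (h n) φ hφ] at h1
  exact h1.unique h2

/-! ### The Hermite functions as eigenfunctions -/

/-- The eigenvalue `|β| / 2` of `L - N / 2`. -/
noncomputable def eigenvalue {N : ℕ} (β : Fin N → ℕ) : ℝ := (∑ i, (β i : ℝ)) / 2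

theorem eigenvalue_nonneg {N : ℕ} (β : Fin N → ℕ) : 0 ≤ eigenvalue β := by
  unfold eigenvalue
  positivity

theorem weakL_hermiteE {N : ℕ} (β : Fin N → ℕ) :
    WeakL (hermiteE β) ((eigenvalue β + (N : ℝ) / 2) • hermiteE β) := by
  suffices h : WeakL (gaussL2 (hermiteTensor β))
      ((eigenvalue β + (N : ℝ) / 2) • gaussL2 (hermiteTensor β)) by
    have := h.smul (√(hermiteNormSq β))⁻¹
    rwa [smul_comm] at this
  intro φ h1 h2
  rw [(integral_mul_adjointL (fun i => hasWeakDeriv_gaussL2 (Pi.single i 1) β)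
    (fun i => hasWeakDeriv_gaussL2 (Pi.single i 2) β) ⟨h1, h2⟩).2]
  refine integral_congr_ae ?_
  have hall := ae_all_iff.2 fun γ : Fin N → ℕ => coeFn_gaussL2 (hermiteTensor γ)
  filter_upwards [hall, ae_weightMeasure_iff.1 (Lp.coeFn_smul (eigenvalue β + (N : ℝ) / 2)
    (gaussL2 (hermiteTensor β)))] with y hy hy'
  rw [hy', Pi.smul_apply, smul_eq_mul]
  simp only [hy]
  congr 1
  -- Derivatives of the Hermite functions raise the index, so the eigenvalue equation in each
  -- coordinate is the three-term recurrence.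
  have key : ∀ i, gaussTensor (hermiteTensor (β + Pi.single i 2)) y +
      y i * gaussTensor (hermiteTensor (β + Pi.single i 1)) y / 2 +
      ((β i : ℝ) / 2 + 1 / 2) * gaussTensor (hermiteTensor β) y = 0 := fun i => by
    have hu : ∀ k, β + Pi.single i k = Function.update β i (β i + k) := fun k => by
      funext j
      by_cases h : j = i
      · subst h
        simp
      · simp [h]
    rw [hu, hu, ← update_hermiteTensor, ← update_hermiteTensor, gaussTensor, gaussTensor,
      gaussTensor, polyTensor_update, polyTensor_update, polyTensor_eq _ i]
    have := hermiteP_recurrence (β i) (y i)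
    rw [show (hermiteP (β i + 2)).eval (y i) = -(y i / 2 * (hermiteP (β i + 1)).eval (y i)) -
      ((β i : ℝ) + 1) / 2 * (hermiteP (β i)).eval (y i) by linarith,
      show hermiteTensor β i = hermiteP (β i) from rfl]
    ring
  have hsum := Finset.sum_congr rfl fun i (_ : i ∈ Finset.univ) => key i
  rw [Finset.sum_add_distrib, Finset.sum_add_distrib, ← Finset.sum_div, ← Finset.sum_mul,
    Finset.sum_add_distrib, ← Finset.sum_div] at hsum
  simp only [Finset.sum_const, Finset.card_univ, Fintype.card_fin, nsmul_eq_mul, smul_zero] at hsum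
  rw [eigenvalue]
  linarith

/-- `L` is symmetric for `K dy`, so multiplication by `K` conjugates it to its `dy`-adjoint. As `K
e_β` is a multiple of a Hermite polynomial, that polynomial is an eigenfunction of the adjoint for
the same eigenvalue. -/
theorem adjointL_polyTensor {N : ℕ} (β : Fin N → ℕ) (y : Space N) :
    adjointL (polyTensor (hermiteTensor β)) y =
      (eigenvalue β + (N : ℝ) / 2) * polyTensor (hermiteTensor β) y := by
  rw [adjointL_eq (contDiff_polyTensor _)]
  have key : ∀ i, -partialD i (partialD i (polyTensor (hermiteTensor β))) y +
      (polyTensor (hermiteTensor β) y + y i * partialD i (polyTensor (hermiteTensor β)) y) / 2 =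
      ((β i : ℝ) / 2 + 1 / 2) * polyTensor (hermiteTensor β) y := fun i => by
    rw [partialD_polyTensor, partialD_polyTensor, Function.update_idem, Function.update_self,
      polyTensor_update, polyTensor_update, polyTensor_eq _ i]
    have := hermiteP_ode (β i) (y i)
    rw [show hermiteTensor β i = hermiteP (β i) from rfl,
      show (hermiteP (β i)).derivative.derivative.eval (y i) =
        y i / 2 * (hermiteP (β i)).derivative.eval (y i) - β i / 2 * (hermiteP (β i)).eval (y i)
        by linarith]
    ring
  rw [Finset.sum_congr rfl fun i _ => key i, ← Finset.sum_mul, Finset.sum_add_distrib,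
    ← Finset.sum_div, eigenvalue]
  simp
  ring_nf
  simp

/-! ### Testing with functions of exponential growth -/

theorem partialD_comp_smul {N : ℕ} (i : Fin N) (φ : Space N → ℝ) (ε : ℝ) (y : Space N) :
    partialD i (fun y => φ (ε • y)) y = ε * partialD i φ (ε • y) := by
  rw [partialD, fderiv_comp_smul]
  simp [partialD]

theorem tendsto_integral_mul_comp_smul {N : ℕ} (u : L2K N) {g Q : Space N → ℝ}
    (hg : Continuous g) (hs : HasCompactSupport g) (hQ : ExpBdd Q) {ε : ℕ → ℝ}
    (hε : Tendsto ε atTop (𝓝 0)) :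
    Tendsto (fun n => ∫ y, u y * (g (ε n • y) * Q y)) atTop (𝓝 (g 0 * ∫ y, u y * Q y)) := by
  obtain ⟨C, hC⟩ := hs.exists_bound_of_continuous hg
  rw [← integral_const_mul]
  refine tendsto_integral_of_dominated_convergence (fun y => C * ‖u y * Q y‖) (fun n => ?_)
    ((hQ.integrable_mul u).norm.const_mul C) (fun n => Eventually.of_forall fun y => ?_)
    (Eventually.of_forall fun y => ?_)
  · have := (hQ.integrable_mul u).aestronglyMeasurable.mul
      (hg.comp (continuous_const_smul (ε n))).aestronglyMeasurable
    refine this.congr (Eventually.of_forall fun y => ?_)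
    simp only [Pi.mul_apply, Function.comp_apply]
    ring
  · rw [mul_left_comm, norm_mul]
    exact mul_le_mul_of_nonneg_right (hC _) (norm_nonneg _)
  · have h1 : Tendsto (fun n => g (ε n • y)) atTop (𝓝 (g 0)) := by
      have := (hg.tendsto ((0 : ℝ) • y)).comp (hε.smul_const y)
      simpa [Function.comp_def] using this
    exact (h1.mul_const (u y * Q y)).congr fun n => by ring

/-- The errors are arranged so that each disappears as `ε → 0`: two carry a power of `ε`, and the
drift term, whose factor `y_i` is unbounded, absorbs its `ε` into `z_i ∂_i χ(z)` at `z = ε y`, a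
test function of `z` vanishing at `0`. -/
theorem adjointL_cutoff {N : ℕ} {χ P : Space N → ℝ} (hχ : ContDiff ℝ ∞ χ) (hP : ContDiff ℝ ∞ P)
    (ε : ℝ) (y : Space N) :
    adjointL (fun y => χ (ε • y) * P y) y = χ (ε • y) * adjointL P y +
      ∑ i, (-(ε ^ 2 * (partialD i (partialD i χ) (ε • y) * P y)) -
        2 * ε * (partialD i χ (ε • y) * partialD i P y) +
        1 / 2 * ((ε • y) i * partialD i χ (ε • y) * P y)) := by
  have hs : ∀ {f : Space N → ℝ}, ContDiff ℝ ∞ f → ContDiff ℝ ∞ fun y => f (ε • y) :=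
    fun hf => hf.comp (contDiff_const_smul ε)
  have h1 : ∀ i, partialD i (fun y => χ (ε • y) * P y) =
      fun y => ε * (partialD i χ (ε • y) * P y) + χ (ε • y) * partialD i P y := fun i => by
    rw [partialD_mul i (hs hχ) hP]
    funext y
    rw [partialD_comp_smul]
    ring
  have h2 : ∀ i, partialD i (partialD i (fun y => χ (ε • y) * P y)) y =
      ε ^ 2 * (partialD i (partialD i χ) (ε • y) * P y) +
        2 * ε * (partialD i χ (ε • y) * partialD i P y) +
        χ (ε • y) * partialD i (partialD i P) y := fun i => by
    have hχ' := hs (contDiff_partialD i hχ)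
    have hP' := contDiff_partialD i hP
    have e1 := congrFun (partialD_mul i hχ' hP) y
    have e2 := congrFun (partialD_mul i (hs hχ) hP') y
    rw [partialD_comp_smul] at e1 e2
    rw [h1, partialD]
    rw [partialD] at e1 e2
    rw [fderiv_fun_add (((hχ'.mul hP).differentiable (by simp) y).const_mul ε)
      (((hs hχ).mul hP').differentiable (by simp) y),
      fderiv_const_mul ((hχ'.mul hP).differentiable (by simp) y), add_apply, smul_apply, e1, e2,
      smul_eq_mul]
    ring
  rw [adjointL_eq ((hs hχ).mul hP), adjointL_eq hP, Finset.mul_sum, ← Finset.sum_add_distrib]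
  refine Finset.sum_congr rfl fun i _ => ?_
  rw [h2, h1]
  simp only [PiLp.smul_apply, smul_eq_mul]
  ring

/-- Extends the weak equation to test functions of exponential growth by testing with `χ(ε y) P(y)`
and letting `ε → 0`. No derivative of `u` enters. -/
theorem WeakL.integral_eq {N : ℕ} {u f : L2K N} (h : WeakL u f) {P : Space N → ℝ}
    (hP : ContDiff ℝ ∞ P) (h0 : ExpBdd P) (h1 : ∀ i, ExpBdd (partialD i P))
    (h2 : ExpBdd (adjointL P)) : ∫ y, u y * adjointL P y = ∫ y, f y * P y := by
  let b : ContDiffBump (0 : Space N) := ⟨1, 2, by norm_num, by norm_num⟩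
  have hχ : ContDiff ℝ ∞ b ∧ HasCompactSupport b := ⟨b.contDiff, b.hasCompactSupport⟩
  have hb0 : b 0 = 1 := b.one_of_mem_closedBall (by simp [b.rIn_pos.le])
  have hε : Tendsto (fun n : ℕ => 1 / ((n : ℝ) + 1)) atTop (𝓝 0) :=
    tendsto_one_div_add_atTop_nhds_zero_nat
  have lim := fun {g Q : Space N → ℝ} (hg : ContDiff ℝ ∞ g ∧ HasCompactSupport g) (hQ : ExpBdd Q) =>
    tendsto_integral_mul_comp_smul u hg.1.continuous hg.2 hQ hε
  have limf := tendsto_integral_mul_comp_smul f hχ.1.continuous hχ.2 h0 hε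
  have limL := lim hχ h2
  have limi := fun i => ((((hε.pow 2).mul (lim (partialD_smooth i (partialD_smooth i hχ)) h0)).neg.sub
    ((hε.const_mul 2).mul (lim (partialD_smooth i hχ) (h1 i)))).add
    ((lim (coord_mul_smooth i (partialD_smooth i hχ)) h0).const_mul (1 / 2)))
  have total := limL.add (tendsto_finsetSum Finset.univ fun i _ => limi i)
  simp only [hb0, one_mul, PiLp.zero_apply, zero_mul, mul_zero, neg_zero, sub_zero, add_zero,
    ne_eq, OfNat.ofNat_ne_zero, not_false_eq_true, zero_pow, Finset.sum_const_zero] at total limf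
  refine tendsto_nhds_unique total (limf.congr fun n => ?_)
  have hε0 : (1 / ((n : ℝ) + 1)) ≠ 0 := by positivity
  set ε := 1 / ((n : ℝ) + 1)
  have hint : ∀ {g Q : Space N → ℝ}, ContDiff ℝ ∞ g ∧ HasCompactSupport g → ExpBdd Q →
      Integrable fun y => u y * (g (ε • y) * Q y) := fun {g Q} hg hQ =>
    ExpBdd.integrable_mul (φ := fun y => g (ε • y) * Q y) (ExpBdd.mul
      (.of_hasCompactSupport (hg.1.continuous.comp (continuous_const_smul ε))
        (hg.2.comp_homeomorph (Homeomorph.smulOfNeZero ε hε0))) hQ) u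
  have htest : ContDiff ℝ ∞ (fun y => b (ε • y) * P y) ∧
      HasCompactSupport fun y => b (ε • y) * P y :=
    ⟨(hχ.1.comp (contDiff_const_smul ε)).mul hP,
      (hχ.2.comp_homeomorph (Homeomorph.smulOfNeZero ε hε0)).mul_right⟩
  rw [← h _ htest.1 htest.2]
  have i1 := fun i => (hint (partialD_smooth i (partialD_smooth i hχ)) h0).const_mul (ε ^ 2)
  have i2 := fun i => (hint (partialD_smooth i hχ) (h1 i)).const_mul (2 * ε)
  have i3 := fun i => (hint (coord_mul_smooth i (partialD_smooth i hχ)) h0).const_mul (1 / 2)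
  have e : (fun y => u y * adjointL (fun y => b (ε • y) * P y) y) = fun y =>
      u y * (b (ε • y) * adjointL P y) +
      ∑ i, (-(ε ^ 2 * (u y * (partialD i (partialD i b) (ε • y) * P y))) -
        2 * ε * (u y * (partialD i b (ε • y) * partialD i P y)) +
        1 / 2 * (u y * ((ε • y) i * partialD i b (ε • y) * P y))) := by
    funext y
    rw [adjointL_cutoff hχ.1 hP, mul_add, Finset.mul_sum]
    congr 1
    exact Finset.sum_congr rfl fun i _ => by ring
  have i4 : ∀ i, Integrable fun y =>
      (-(ε ^ 2 * (u y * (partialD i (partialD i b) (ε • y) * P y))) -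
        2 * ε * (u y * (partialD i b (ε • y) * partialD i P y)) +
        1 / 2 * (u y * ((ε • y) i * partialD i b (ε • y) * P y))) :=
    fun i => ((i1 i).neg.sub (i2 i)).add (i3 i)
  rw [e, integral_add (hint hχ h2) (integrable_finsetSum _ fun i _ => i4 i),
    integral_finsetSum _ fun i _ => i4 i]
  congr 1
  refine Finset.sum_congr rfl fun i _ => ?_
  have a1 := integral_add ((i1 i).neg.sub (i2 i)) (i3 i)
  have a2 := integral_sub (i1 i).neg (i2 i)
  simp only [Pi.neg_apply, Pi.sub_apply] at a1 a2
  rw [a1, a2, integral_neg, integral_const_mul, integral_const_mul, integral_const_mul]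

/-- Testing with the Hermite polynomial, an eigenfunction of the adjoint, reads off the coefficient.
Both the generator and the uniqueness argument rest on this. -/
theorem WeakL.inner_hermiteE {N : ℕ} {u f : L2K N} (h : WeakL u f) (β : Fin N → ℕ) :
    inner ℝ (hermiteE β) f = (eigenvalue β + (N : ℝ) / 2) * inner ℝ (hermiteE β) u := by
  have hL : adjointL (polyTensor (hermiteTensor β)) =
      fun y => (eigenvalue β + (N : ℝ) / 2) * polyTensor (hermiteTensor β) y :=
    funext (adjointL_polyTensor β)
  have key := h.integral_eq (contDiff_polyTensor (hermiteTensor β)) (.polyTensor _)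
    (fun i => by rw [partialD_polyTensor]; exact .polyTensor _)
    (by rw [hL]; exact (ExpBdd.polyTensor _).const_mul _)
  simp only [hL, mul_left_comm _ (eigenvalue β + (N : ℝ) / 2)] at key
  rw [integral_const_mul] at key
  rw [hermiteE, real_inner_smul_left, real_inner_smul_left, inner_gaussL2, inner_gaussL2, ← key]
  ring

/-! ### Multipliers and weighted shifts for the Hermite basis -/

theorem ext_inner_hilbertBasis {ι H : Type*} [NormedAddCommGroup H] [InnerProductSpace ℝ H]
    (b : HilbertBasis ι ℝ H) {u v : H}
    (h : ∀ i, inner ℝ (b i) u = inner ℝ (b i) v) : u = v := by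
  refine b.repr.injective (lp.ext (funext fun i => ?_))
  rw [b.repr_apply_apply, b.repr_apply_apply, h]

theorem hasSum_sq_inner {ι H : Type*} [NormedAddCommGroup H] [InnerProductSpace ℝ H]
    (b : HilbertBasis ι ℝ H) (u : H) : HasSum (fun i => (inner ℝ (b i) u) ^ 2) (‖u‖ ^ 2) := by
  have h := b.hasSum_inner_mul_inner u u
  rw [real_inner_self_eq_norm_sq] at h
  convert! h using 2 with i
  rw [real_inner_comm u, sq]

section WeightedShift

variable {ι H : Type*} [NormedAddCommGroup H] [InnerProductSpace ℝ H] [CompleteSpace H]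

/-- The operator `u ↦ ∑ i, a_i (b_i, u) e_i` for a Hilbert basis `b`, an orthonormal family `e` and
a bounded sequence `a`. -/
noncomputable def weightedShift (b : HilbertBasis ι ℝ H) {e : ι → H} (he : Orthonormal ℝ e)
    (a : ι → ℝ) {M : ℝ} (ha : ∀ i, |a i| ≤ M) (hM : 0 ≤ M) : H →L[ℝ] H :=
  he.orthogonalFamily.linearIsometry.toContinuousLinearMap ∘L
    lp.mapCLM 2 (fun i => a i • ContinuousLinearMap.id ℝ ℝ) hM
      (fun i => by
        rw [norm_smul, Real.norm_eq_abs]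
        exact (mul_le_of_le_one_right (abs_nonneg _) ContinuousLinearMap.norm_id_le).trans (ha i)) ∘L
    (b.repr.toLinearIsometry.toContinuousLinearMap)

variable (b : HilbertBasis ι ℝ H) {e : ι → H} (he : Orthonormal ℝ e) (a : ι → ℝ) {M : ℝ}
  (ha : ∀ i, |a i| ≤ M) (hM : 0 ≤ M)

theorem hasSum_weightedShift (u : H) :
    HasSum (fun i => (a i * inner ℝ (b i) u) • e i) (weightedShift b he a ha hM u) := by
  have h := he.orthogonalFamily.hasSum_linearIsometry
    (lp.mapCLM 2 (fun i => a i • ContinuousLinearMap.id ℝ ℝ) hM (fun i => by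
        rw [norm_smul, Real.norm_eq_abs]
        exact (mul_le_of_le_one_right (abs_nonneg _) ContinuousLinearMap.norm_id_le).trans (ha i))
      (b.repr u))
  convert! h using 2 with i
  simp [b.repr_apply_apply]

theorem inner_weightedShift (u : H) (i : ι) :
    inner ℝ (e i) (weightedShift b he a ha hM u) = a i * inner ℝ (b i) u := by
  classical
  have h := (hasSum_weightedShift b he a ha hM u).mapL (innerSL ℝ (e i))
  have h2 := hasSum_ite_eq i (a i * inner ℝ (b i) u)
  refine h.unique (h2.congr_fun fun j => ?_)
  simp only [innerSL_apply_apply, real_inner_smul_right, orthonormal_iff_ite.1 he]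
  by_cases hij : j = i
  · subst hij
    simp
  · simp [hij, Ne.symm hij]

theorem hasSum_sq_weightedShift (u : H) :
    HasSum (fun i => (a i * inner ℝ (b i) u) ^ 2) (‖weightedShift b he a ha hM u‖ ^ 2) := by
  have h := (hasSum_weightedShift b he a ha hM u).mapL
    (innerSL ℝ (weightedShift b he a ha hM u))
  simp only [innerSL_apply_apply, real_inner_self_eq_norm_sq, real_inner_smul_right] at h
  convert! h using 2 with i
  rw [real_inner_comm (e i), inner_weightedShift]
  ring

end WeightedShift

/-! ### Coefficients with respect to the Hermite basis -/

theorem ext_inner_hermiteE {N : ℕ} {u v : L2K N}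
    (h : ∀ β, inner ℝ (hermiteE β) u = inner ℝ (hermiteE β) v) : u = v :=
  ext_inner_hilbertBasis (hermiteBasis N) fun β => by rw [hermiteBasis_apply, h]

theorem hasSum_sq_inner_hermiteE {N : ℕ} (u : L2K N) :
    HasSum (fun β : Fin N → ℕ => (inner ℝ (hermiteE β) u) ^ 2) (‖u‖ ^ 2) := by
  simpa only [hermiteBasis_apply] using hasSum_sq_inner (hermiteBasis N) u

theorem norm_le_of_abs_inner_le {N : ℕ} {u v : L2K N} {C : ℝ} (hC : 0 ≤ C)
    (h : ∀ β, |inner ℝ (hermiteE β) v| ≤ C * |inner ℝ (hermiteE β) u|) : ‖v‖ ≤ C * ‖u‖ := by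
  refine le_of_sq_le_sq ?_ (by positivity)
  rw [mul_pow]
  refine hasSum_le (fun β => ?_) (hasSum_sq_inner_hermiteE v)
    ((hasSum_sq_inner_hermiteE u).mul_left (C ^ 2))
  rw [← sq_abs, ← sq_abs (inner ℝ (hermiteE β) u), ← mul_pow]
  exact pow_le_pow_left₀ (abs_nonneg _) (h β) 2

/-- Dominated convergence in the Parseval series of `v n - w`. -/
theorem tendsto_of_inner_hermiteE {N : ℕ} {ι : Type*} {l : Filter ι} {v : ι → L2K N} {w : L2K N}
    {g : (Fin N → ℕ) → ℝ} (hg : Summable g)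
    (hb : ∀ᶠ n in l, ∀ β, (inner ℝ (hermiteE β) (v n - w)) ^ 2 ≤ g β)
    (h : ∀ β, Tendsto (fun n => inner ℝ (hermiteE β) (v n)) l (𝓝 (inner ℝ (hermiteE β) w))) :
    Tendsto v l (𝓝 w) := by
  rw [tendsto_iff_norm_sub_tendsto_zero]
  have h1 : Tendsto (fun n => ‖v n - w‖ ^ 2) l (𝓝 0) := by
    have := tendsto_tsum_of_dominated_convergence (𝓕 := l)
      (f := fun n β => (inner ℝ (hermiteE β) (v n - w)) ^ 2)
      (g := fun _ : Fin N → ℕ => (0 : ℝ)) hg (fun β => ?_) (hb.mono fun n hn β => ?_)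
    · simpa only [(hasSum_sq_inner_hermiteE _).tsum_eq, tsum_zero] using this
    · have h2 := ((h β).sub_const (inner ℝ (hermiteE β) w)).pow 2
      simpa [inner_sub_right] using h2
    · rw [Real.norm_eq_abs, abs_of_nonneg (sq_nonneg _)]
      exact hn β
  have h2 := h1.sqrt
  simpa using h2

/-! ### Multipliers and weighted shifts -/

/-- Boundedness of a family of real numbers. -/
def IsBdd {ι : Type*} (a : ι → ℝ) : Prop := ∃ M, 0 ≤ M ∧ ∀ i, |a i| ≤ M

theorem IsBdd.of_le {ι : Type*} {a : ι → ℝ} {M : ℝ} (h : ∀ i, |a i| ≤ M) : IsBdd a :=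
  ⟨|M|, abs_nonneg _, fun i => (h i).trans (le_abs_self M)⟩

theorem orthonormal_hermiteE_add {N : ℕ} (α : Fin N → ℕ) :
    Orthonormal ℝ fun β : Fin N → ℕ => hermiteE (β + α) :=
  (orthonormal_hermiteE N).comp _ (add_left_injective α)

open Classical in
/-- The operator `u ↦ ∑ β, a_β (e_β, u) e_{β + α}` for a bounded family `a` (and `0` otherwise). -/
noncomputable def shiftOp {N : ℕ} (α : Fin N → ℕ) (a : (Fin N → ℕ) → ℝ) : L2K N →L[ℝ] L2K N :=
  if h : IsBdd a then weightedShift (hermiteBasis N) (orthonormal_hermiteE_add α) a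
    h.choose_spec.2 h.choose_spec.1 else 0

theorem hasSum_shiftOp {N : ℕ} {α : Fin N → ℕ} {a : (Fin N → ℕ) → ℝ} (ha : IsBdd a) (u : L2K N) :
    HasSum (fun β => (a β * inner ℝ (hermiteE β) u) • hermiteE (β + α)) (shiftOp α a u) := by
  have := hasSum_weightedShift (hermiteBasis N) (orthonormal_hermiteE_add α) a
    ha.choose_spec.2 ha.choose_spec.1 u
  rw [shiftOp, dif_pos ha]
  simpa only [hermiteBasis_apply] using this

theorem hasSum_sq_shiftOp {N : ℕ} {α : Fin N → ℕ} {a : (Fin N → ℕ) → ℝ} (ha : IsBdd a)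
    (u : L2K N) :
    HasSum (fun β => (a β * inner ℝ (hermiteE β) u) ^ 2) (‖shiftOp α a u‖ ^ 2) := by
  have := hasSum_sq_weightedShift (hermiteBasis N) (orthonormal_hermiteE_add α) a
    ha.choose_spec.2 ha.choose_spec.1 u
  rw [shiftOp, dif_pos ha]
  simpa only [hermiteBasis_apply] using this

theorem inner_shiftOp {N : ℕ} {α : Fin N → ℕ} {a : (Fin N → ℕ) → ℝ} (ha : IsBdd a) (u : L2K N)
    (β : Fin N → ℕ) :
    inner ℝ (hermiteE (β + α)) (shiftOp α a u) = a β * inner ℝ (hermiteE β) u := by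
  have := inner_weightedShift (hermiteBasis N) (orthonormal_hermiteE_add α) a
    ha.choose_spec.2 ha.choose_spec.1 u β
  rw [shiftOp, dif_pos ha]
  simpa only [hermiteBasis_apply] using this

/-- The operator `u ↦ ∑ β, a_β (e_β, u) e_β` for a bounded family `a`. -/
noncomputable def mulOp {N : ℕ} (a : (Fin N → ℕ) → ℝ) : L2K N →L[ℝ] L2K N := shiftOp 0 a

theorem inner_mulOp {N : ℕ} {a : (Fin N → ℕ) → ℝ} (ha : IsBdd a) (u : L2K N) (β : Fin N → ℕ) :
    inner ℝ (hermiteE β) (mulOp a u) = a β * inner ℝ (hermiteE β) u := by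
  simpa [mulOp] using inner_shiftOp (α := 0) ha u β

theorem hasSum_mulOp {N : ℕ} {a : (Fin N → ℕ) → ℝ} (ha : IsBdd a) (u : L2K N) :
    HasSum (fun β => (a β * inner ℝ (hermiteE β) u) • hermiteE β) (mulOp a u) := by
  simpa [mulOp] using hasSum_shiftOp (α := 0) ha u

theorem shiftOp_mulOp {N : ℕ} {α : Fin N → ℕ} {a b c : (Fin N → ℕ) → ℝ} (ha : IsBdd a)
    (hb : IsBdd b) (hc : IsBdd c) (h : ∀ β, c β = a β * b β) (u : L2K N) :
    shiftOp α a (mulOp b u) = shiftOp α c u := by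
  refine (hasSum_shiftOp ha _).unique ((hasSum_shiftOp hc u).congr_fun fun β => ?_)
  rw [inner_mulOp hb, h, mul_assoc]

/-- Termwise differentiation of the Hermite expansion, legitimate because both series converge in
`L²(K)` and weak differentiation is closed. -/
theorem hasWeakDeriv_mulOp {N : ℕ} {α : Fin N → ℕ} {a : (Fin N → ℕ) → ℝ} (ha : IsBdd a)
    (hα : IsBdd fun β => a β * shiftFactor α β) (u : L2K N) :
    HasWeakDeriv α (mulOp a u) (shiftOp α (fun β => a β * shiftFactor α β) u) := by
  refine .of_hasSum (fun β => ?_) (hasSum_mulOp ha u) (hasSum_shiftOp hα u)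
  have := (hasWeakDeriv_hermiteE α β).smul (a β * inner ℝ (hermiteE β) u)
  rw [smul_smul] at this
  convert! this using 2
  ring

theorem weakL_mulOp {N : ℕ} {a : (Fin N → ℕ) → ℝ} (ha : IsBdd a)
    (h : IsBdd fun β => a β * (eigenvalue β + (N : ℝ) / 2)) (u : L2K N) :
    WeakL (mulOp a u) (mulOp (fun β => a β * (eigenvalue β + (N : ℝ) / 2)) u) := by
  refine .of_hasSum (fun β => ?_) (hasSum_mulOp ha u) (hasSum_mulOp h u)
  have := (weakL_hermiteE β).smul (a β * inner ℝ (hermiteE β) u)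
  rw [smul_smul] at this
  convert! this using 2
  ring

/-! ### Bounds for the shift factors -/

theorem shiftFactor_nonneg {N : ℕ} (α β : Fin N → ℕ) : 0 ≤ shiftFactor α β := by
  unfold shiftFactor
  positivity

theorem shiftFactor_sq {N : ℕ} (α β : Fin N → ℕ) :
    shiftFactor α β ^ 2 = hermiteNormSq (β + α) / hermiteNormSq β := by
  rw [shiftFactor, div_pow, Real.sq_sqrt (hermiteNormSq_pos _).le,
    Real.sq_sqrt (hermiteNormSq_pos _).le]

theorem shiftFactor_zero {N : ℕ} (β : Fin N → ℕ) : shiftFactor 0 β = 1 := by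
  rw [shiftFactor, add_zero, div_self (Real.sqrt_pos.2 (hermiteNormSq_pos β)).ne']

theorem shiftFactor_single_sq {N : ℕ} (i : Fin N) (β : Fin N → ℕ) :
    shiftFactor (Pi.single i 1) β ^ 2 = ((β i : ℝ) + 1) / 2 := by
  rw [shiftFactor_sq, hermiteNormSq, hermiteNormSq, ← Finset.prod_div_distrib,
    Finset.prod_eq_single i]
  · simp only [Pi.add_apply, Pi.single_eq_same, Nat.factorial_succ, pow_succ]
    push_cast
    have : ((β i).factorial : ℝ) ≠ 0 := by positivity
    field_simp
  · intro j _ hj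
    simp only [Pi.add_apply, Pi.single_eq_of_ne hj, add_zero]
    have : ((β j).factorial : ℝ) ≠ 0 := by positivity
    field_simp
  · simp

/-- The squared factor is `∏ j, (β_j + 1) ⋯ (β_j + α_j) / 2^{α_j}`, and each of its at most `m`
linear factors is at most `|β| + m`. The extra `1` keeps the base at least `1`, so that the exponent
`|α|` can be raised to `m`. -/
theorem shiftFactor_sq_le {N m : ℕ} {α : Fin N → ℕ} (hα : ∑ i, α i ≤ m) (β : Fin N → ℕ) :
    shiftFactor α β ^ 2 ≤ (2 * eigenvalue β + m + 1) ^ m := by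
  have h0 : 2 * eigenvalue β = ∑ i, (β i : ℝ) := by rw [eigenvalue]; ring
  have hbase : 1 ≤ 2 * eigenvalue β + m + 1 := by
    have := eigenvalue_nonneg β
    have : (0 : ℝ) ≤ m := m.cast_nonneg
    linarith
  rw [shiftFactor_sq, hermiteNormSq, hermiteNormSq, ← Finset.prod_div_distrib]
  calc _ ≤ ∏ j, (2 * eigenvalue β + m + 1) ^ α j := by
        refine Finset.prod_le_prod (fun j _ => by positivity) fun j _ => ?_
        have h1 : ((β + α) j).factorial = (β j).factorial * (β j + 1).ascFactorial (α j) :=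
          (Nat.factorial_mul_ascFactorial _ _).symm
        have h2 : ((β j + 1).ascFactorial (α j) : ℝ) ≤ ((β j : ℝ) + α j) ^ α j := by
          exact_mod_cast Nat.ascFactorial_le_pow_add _ _
        have h3 : (β j : ℝ) + α j ≤ 2 * eigenvalue β + m + 1 := by
          have e1 : (β j : ℝ) ≤ 2 * eigenvalue β := by
            rw [h0]
            exact Finset.single_le_sum (f := fun i => (β i : ℝ)) (fun i _ => by positivity)
              (Finset.mem_univ j)
          have e2 : (α j : ℝ) ≤ m := by
            exact_mod_cast (Finset.single_le_sum (f := α) (fun i _ => Nat.zero_le _)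
              (Finset.mem_univ j)).trans hα
          linarith
        rw [h1, Pi.add_apply, pow_add]
        push_cast
        have e : ((β j).factorial : ℝ) * ((β j + 1).ascFactorial (α j)) / (2 ^ β j * 2 ^ α j) /
            ((β j).factorial / 2 ^ β j) = ((β j + 1).ascFactorial (α j)) / 2 ^ α j := by
          have : ((β j).factorial : ℝ) ≠ 0 := by positivity
          field_simp
        rw [e]
        refine (div_le_self (by positivity) (one_le_pow₀ one_le_two)).trans (h2.trans ?_)
        exact pow_le_pow_left₀ (by positivity) h3 _
    _ = (2 * eigenvalue β + m + 1) ^ (∑ j, α j) := Finset.prod_pow_eq_pow_sum _ _ _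
    _ ≤ _ := pow_le_pow_right₀ hbase hα

theorem mul_exp_neg_le_one (x : ℝ) : x * Real.exp (-x) ≤ 1 := by
  have h := Real.add_one_le_exp x
  rw [Real.exp_neg, ← div_eq_mul_inv, div_le_one (Real.exp_pos x)]
  linarith

theorem isBdd_exp {N : ℕ} {s : ℝ} (hs : 0 ≤ s) :
    IsBdd fun β : Fin N → ℕ => Real.exp (-(eigenvalue β * s)) :=
  .of_le (M := 1) fun β => by
    rw [Real.abs_exp, Real.exp_le_one_iff, neg_nonpos]
    exact mul_nonneg (eigenvalue_nonneg β) hs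

theorem isBdd_exp_mul_eigenvalue {N : ℕ} {s : ℝ} (hs : 0 < s) :
    IsBdd fun β : Fin N → ℕ => Real.exp (-(eigenvalue β * s)) * eigenvalue β :=
  .of_le (M := 1 / s) fun β => by
    rw [abs_of_nonneg (mul_nonneg (Real.exp_pos _).le (eigenvalue_nonneg β)), le_div_iff₀ hs]
    linarith [mul_exp_neg_le_one (eigenvalue β * s)]

theorem isBdd_exp_mul_shiftFactor {N m : ℕ} {α : Fin N → ℕ} (hα : ∑ i, α i ≤ m) {s : ℝ}
    (hs : 0 < s) :
    IsBdd fun β : Fin N → ℕ => Real.exp (-(eigenvalue β * s)) * shiftFactor α β := by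
  refine .of_le (M := 1 + m.factorial / (s / 2) ^ m * Real.exp ((m + 1) * (s / 2))) fun β => ?_
  rw [abs_of_nonneg (mul_nonneg (Real.exp_pos _).le (shiftFactor_nonneg α β))]
  have hl := eigenvalue_nonneg β
  -- In `x^m / m! ≤ exp x` this `x` is chosen so that the part of `exp x` depending on `β` is
  -- exactly `exp(λ_β s)`.
  have hx : 0 ≤ (2 * eigenvalue β + m + 1) * (s / 2) := by positivity
  have h1 := Real.pow_div_factorial_le_exp _ hx m
  rw [mul_pow, div_le_iff₀ (by positivity), ← le_div_iff₀ (by positivity)] at h1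
  have h2 := (shiftFactor_sq_le hα β).trans h1
  have h3 : shiftFactor α β ≤ 1 + shiftFactor α β ^ 2 := by
    nlinarith [sq_nonneg (shiftFactor α β - 1), sq_nonneg (shiftFactor α β)]
  have h4 : Real.exp (-(eigenvalue β * s)) ≤ 1 := by
    rw [Real.exp_le_one_iff, neg_nonpos]
    positivity
  have h5 : Real.exp (-(eigenvalue β * s)) * Real.exp ((2 * eigenvalue β + m + 1) * (s / 2)) =
      Real.exp ((m + 1) * (s / 2)) := by
    rw [← Real.exp_add]
    congr 1
    ring
  calc Real.exp (-(eigenvalue β * s)) * shiftFactor α β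
      ≤ Real.exp (-(eigenvalue β * s)) * (1 + Real.exp ((2 * eigenvalue β + m + 1) * (s / 2)) *
          m.factorial / (s / 2) ^ m) := by
        gcongr
        exact h3.trans (by linarith)
    _ = Real.exp (-(eigenvalue β * s)) + m.factorial / (s / 2) ^ m *
          (Real.exp (-(eigenvalue β * s)) * Real.exp ((2 * eigenvalue β + m + 1) * (s / 2))) := by
        ring
    _ ≤ _ := by
        rw [h5]
        gcongr

/-- Elliptic regularity in coefficients: for order at most two the shift factor is at most `2 λ_β +
3 ≤ 3 (1 + 2 λ_β)`, so `(1 + 2 (L - N/2))⁻¹` maps into `H²(K)`. -/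
theorem isBdd_resolvent_mul_shiftFactor {N : ℕ} {α : Fin N → ℕ} (hα : ∑ i, α i ≤ 2) :
    IsBdd fun β : Fin N → ℕ => (1 + 2 * eigenvalue β)⁻¹ * shiftFactor α β := by
  refine .of_le (M := 3) fun β => ?_
  have hl := eigenvalue_nonneg β
  rw [abs_of_nonneg (mul_nonneg (by positivity) (shiftFactor_nonneg α β)),
    inv_mul_le_iff₀ (by positivity)]
  have h := abs_le_of_sq_le_sq (shiftFactor_sq_le hα β) (by positivity)
  push_cast at h
  linarith [le_abs_self (shiftFactor α β)]

theorem isBdd_resolvent {N : ℕ} : IsBdd fun β : Fin N → ℕ => (1 + 2 * eigenvalue β)⁻¹ := by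
  simpa [shiftFactor_zero] using isBdd_resolvent_mul_shiftFactor (N := N) (α := 0) (by simp)

theorem isBdd_resolvent_mul_eigenvalue {N : ℕ} :
    IsBdd fun β : Fin N → ℕ => (1 + 2 * eigenvalue β)⁻¹ * (eigenvalue β + (N : ℝ) / 2) := by
  refine .of_le (M := 1 + N) fun β => ?_
  have hl := eigenvalue_nonneg β
  have hN : (0 : ℝ) ≤ N := N.cast_nonneg
  rw [abs_of_nonneg (by positivity), inv_mul_le_iff₀ (by positivity)]
  nlinarith [mul_nonneg hl hN]

/-! ### Multipliers with values in `H^m(K)` -/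

/-- The condition under which the multiplier `a` maps `L²(K)` to `H^m(K)`. -/
def IsRegular {N : ℕ} (m : ℕ) (a : (Fin N → ℕ) → ℝ) : Prop :=
  IsBdd a ∧ ∀ α ∈ multiIndices N m, IsBdd fun β => a β * shiftFactor α β

theorem isRegular_exp {N : ℕ} (m : ℕ) {s : ℝ} (hs : 0 < s) :
    IsRegular m fun β : Fin N → ℕ => Real.exp (-(eigenvalue β * s)) :=
  ⟨isBdd_exp hs.le, fun _ hα => isBdd_exp_mul_shiftFactor (mem_multiIndices.1 hα) hs⟩

theorem isRegular_resolvent {N : ℕ} :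
    IsRegular 2 fun β : Fin N → ℕ => (1 + 2 * eigenvalue β)⁻¹ :=
  ⟨isBdd_resolvent, fun _ hα => isBdd_resolvent_mul_shiftFactor (mem_multiIndices.1 hα)⟩

theorem shiftOp_zero_mul_shiftFactor {N : ℕ} (a : (Fin N → ℕ) → ℝ) :
    shiftOp 0 (fun β => a β * shiftFactor 0 β) = mulOp a := by
  simp only [shiftFactor_zero, mul_one, mulOp]

/-- The multiplier `a` as an operator from `L²(K)` to `H^m(K)`. -/
noncomputable def sobolevOp {N m : ℕ} {a : (Fin N → ℕ) → ℝ} (ha : IsRegular m a) :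
    L2K N →L[ℝ] HK N m :=
  ((PiLp.continuousLinearEquiv 2 ℝ fun _ : multiIndices N m => L2K N).symm.toContinuousLinearMap ∘L
    ContinuousLinearMap.pi fun α => shiftOp α.1 fun β => a β * shiftFactor α.1 β).codRestrict
    (HK N m) fun u α => by
      have h := hasWeakDeriv_mulOp ha.1 (ha.2 α.1 α.2) u
      rw [← shiftOp_zero_mul_shiftFactor] at h
      exact h

theorem toL2K_sobolevOp {N m : ℕ} {a : (Fin N → ℕ) → ℝ} (ha : IsRegular m a) (u : L2K N) :
    toL2K (sobolevOp ha u) = mulOp a u := by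
  rw [← shiftOp_zero_mul_shiftFactor]
  rfl

theorem sobolevOp_apply {N m : ℕ} {a : (Fin N → ℕ) → ℝ} (ha : IsRegular m a) (u : L2K N)
    (α : multiIndices N m) :
    (sobolevOp ha u).1 α = shiftOp α.1 (fun β => a β * shiftFactor α.1 β) u := rfl

theorem sobolevOp_mulOp {N m : ℕ} {a b c : (Fin N → ℕ) → ℝ} (ha : IsRegular m a) (hb : IsBdd b)
    (hc : IsRegular m c) (h : ∀ β, c β = a β * b β) (u : L2K N) :
    sobolevOp ha (mulOp b u) = sobolevOp hc u := by
  refine Subtype.ext (PiLp.ext fun α => ?_)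
  rw [sobolevOp_apply, sobolevOp_apply]
  refine shiftOp_mulOp (ha.2 α.1 α.2) hb (hc.2 α.1 α.2) (fun β => ?_) u
  rw [h]
  ring

theorem isL_mulOp {N : ℕ} {a : (Fin N → ℕ) → ℝ} (ha : IsRegular 2 a)
    (h : IsBdd fun β => a β * (eigenvalue β + (N : ℝ) / 2)) (u : L2K N) :
    IsL (mulOp a u) (mulOp (fun β => a β * (eigenvalue β + (N : ℝ) / 2)) u) := by
  have hw := fun {α : Fin N → ℕ} (hα : ∑ i, α i ≤ 2) =>
    hasWeakDeriv_mulOp ha.1 (ha.2 α (mem_multiIndices.2 hα)) u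
  have h1 := fun i : Fin N => hw (α := Pi.single i 1) (by rw [sum_single]; norm_num)
  have h2 := fun i : Fin N => hw (α := Pi.single i 2) (by rw [sum_single])
  exact ⟨⟨sobolevOp ha u, toL2K_sobolevOp ha u⟩, _, _, h1, h2, (weakL_mulOp ha.1 h u).ae_eq h1 h2⟩

/-! ### The semigroup -/

/-- The semigroup generated by `-(L - N / 2)`, extended by the identity to negative times. -/
noncomputable def heatS (N : ℕ) (s : ℝ) : L2K N →L[ℝ] L2K N :=
  mulOp fun β => Real.exp (-(eigenvalue β * max s 0))

theorem heatS_of_nonneg {N : ℕ} {s : ℝ} (hs : 0 ≤ s) :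
    heatS N s = mulOp fun β => Real.exp (-(eigenvalue β * s)) := by
  rw [heatS, max_eq_left hs]

theorem inner_heatS {N : ℕ} {s : ℝ} (hs : 0 ≤ s) (u : L2K N) (β : Fin N → ℕ) :
    inner ℝ (hermiteE β) (heatS N s u) =
      Real.exp (-(eigenvalue β * s)) * inner ℝ (hermiteE β) u := by
  rw [heatS_of_nonneg hs, inner_mulOp (isBdd_exp hs)]

theorem heatS_zero (N : ℕ) : heatS N 0 = ContinuousLinearMap.id ℝ (L2K N) := by
  ext1 u
  refine ext_inner_hermiteE fun β => ?_
  rw [inner_heatS le_rfl]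
  simp

theorem heatS_add {N : ℕ} {s t : ℝ} (hs : 0 ≤ s) (ht : 0 ≤ t) :
    heatS N (s + t) = (heatS N s).comp (heatS N t) := by
  ext1 u
  refine ext_inner_hermiteE fun β => ?_
  rw [ContinuousLinearMap.comp_apply, inner_heatS (add_nonneg hs ht), inner_heatS hs,
    inner_heatS ht, ← mul_assoc, ← Real.exp_add]
  congr 2
  ring

theorem norm_heatS_le {N : ℕ} {s : ℝ} (hs : 0 ≤ s) : ‖heatS N s‖ ≤ 1 := by
  refine ContinuousLinearMap.opNorm_le_bound _ zero_le_one fun u => ?_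
  refine norm_le_of_abs_inner_le zero_le_one fun β => ?_
  rw [inner_heatS hs, abs_mul, Real.abs_exp]
  refine mul_le_mul_of_nonneg_right ?_ (abs_nonneg _)
  rw [Real.exp_le_one_iff, neg_nonpos]
  exact mul_nonneg (eigenvalue_nonneg β) hs

theorem continuous_heatS {N : ℕ} (u : L2K N) : Continuous fun s => heatS N s u := by
  have hi : ∀ (s : ℝ) (β : Fin N → ℕ), inner ℝ (hermiteE β) (heatS N s u) =
      Real.exp (-(eigenvalue β * max s 0)) * inner ℝ (hermiteE β) u := fun s β => by
    rw [heatS, inner_mulOp (isBdd_exp (le_max_right s 0))]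
  have h01 : ∀ (s : ℝ) (β : Fin N → ℕ), Real.exp (-(eigenvalue β * max s 0)) ∈ Icc (0 : ℝ) 1 :=
    fun s β => ⟨(Real.exp_pos _).le, by
      rw [Real.exp_le_one_iff, neg_nonpos]
      exact mul_nonneg (eigenvalue_nonneg β) (le_max_right _ _)⟩
  refine continuous_iff_continuousAt.2 fun s₀ => ?_
  refine tendsto_of_inner_hermiteE (hasSum_sq_inner_hermiteE u).summable
    (Eventually.of_forall fun s β => ?_) fun β => ?_
  · rw [inner_sub_right, hi, hi, ← sub_mul, mul_pow]
    refine mul_le_of_le_one_left (sq_nonneg _) ?_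
    rw [← sq_abs]
    exact pow_le_one₀ (abs_nonneg _) (by
      rw [abs_le]
      have h1 := h01 s β
      have h2 := h01 s₀ β
      constructor <;> linarith [h1.1, h1.2, h2.1, h2.2])
  · simp only [hi]
    exact (by fun_prop : Continuous fun s => Real.exp (-(eigenvalue β * max s 0)) *
      inner ℝ (hermiteE β) u).tendsto s₀

/-- The operator `(L - N / 2) S(s)`. -/
noncomputable def heatG (N : ℕ) (s : ℝ) : L2K N →L[ℝ] L2K N :=
  mulOp fun β => Real.exp (-(eigenvalue β * s)) * eigenvalue β

theorem inner_heatG {N : ℕ} {s : ℝ} (hs : 0 < s) (u : L2K N) (β : Fin N → ℕ) :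
    inner ℝ (hermiteE β) (heatG N s u) =
      Real.exp (-(eigenvalue β * s)) * eigenvalue β * inner ℝ (hermiteE β) u :=
  inner_mulOp (isBdd_exp_mul_eigenvalue hs) u β

/-- Makes the time derivative of an orbit, up to sign, a time-shifted orbit of another element of
`L²(K)`, so that differentiation can be iterated. -/
theorem heatS_heatG {N : ℕ} {s t : ℝ} (hs : 0 ≤ s) (ht : 0 < t) (u : L2K N) :
    heatS N s (heatG N t u) = heatG N (s + t) u := by
  refine ext_inner_hermiteE fun β => ?_
  rw [inner_heatS hs, inner_heatG ht, inner_heatG (by linarith), mul_add, neg_add, Real.exp_add]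
  ring

theorem isL_heatS {N : ℕ} {s : ℝ} (hs : 0 < s) (u : L2K N) :
    IsL (heatS N s u) (heatG N s u + ((N : ℝ) / 2) • heatS N s u) := by
  have hb : IsBdd fun β : Fin N → ℕ => Real.exp (-(eigenvalue β * s)) *
      (eigenvalue β + (N : ℝ) / 2) := by
    obtain ⟨M, hM, h⟩ := isBdd_exp_mul_eigenvalue (N := N) hs
    obtain ⟨M', hM', h'⟩ := isBdd_exp (N := N) hs.le
    refine .of_le (M := M + M' * |(N : ℝ) / 2|) fun β => ?_
    rw [mul_add]
    refine (abs_add_le _ _).trans (add_le_add (h β) ?_)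
    rw [abs_mul]
    exact mul_le_mul_of_nonneg_right (h' β) (abs_nonneg _)
  have h := isL_mulOp (isRegular_exp 2 hs) hb u
  rw [← heatS_of_nonneg hs.le] at h
  convert! h using 1
  refine ext_inner_hermiteE fun β => ?_
  rw [inner_mulOp hb, inner_add_right, real_inner_smul_right, inner_heatG hs, inner_heatS hs.le]
  ring

theorem hasDerivAt_exp_neg_mul (c s : ℝ) :
    HasDerivAt (fun σ => Real.exp (-(c * σ))) (-(Real.exp (-(c * s)) * c)) s := by
  have h := (((hasDerivAt_id s).const_mul c).neg).exp
  convert! h using 1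
  simp

theorem abs_exp_sub_one_le_mul_exp (x : ℝ) : |Real.exp x - 1| ≤ |x| * Real.exp |x| := by
  rcases le_total 0 x with h | h
  · rw [abs_of_nonneg (by linarith [Real.one_le_exp h]), abs_of_nonneg h]
    have h1 := Real.add_one_le_exp (-x)
    have h2 : Real.exp x * Real.exp (-x) = 1 := by rw [← Real.exp_add]; simp
    nlinarith [Real.exp_pos x]
  · rw [abs_of_nonpos (by linarith [Real.exp_le_one_iff.2 h]), abs_of_nonpos h]
    have h1 := Real.add_one_le_exp x
    have h2 := Real.one_le_exp (x := -x) (by linarith)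
    nlinarith

theorem hasDerivAt_heatS {N : ℕ} {s : ℝ} (hs : 0 < s) (u : L2K N) :
    HasDerivAt (fun σ => heatS N σ u) (-heatG N s u) s := by
  rw [hasDerivAt_iff_tendsto_slope_zero]
  have hsmall : ∀ᶠ t in 𝓝[≠] (0 : ℝ), |t| < s / 2 ∧ t ≠ 0 := by
    refine Filter.Eventually.and ?_ self_mem_nhdsWithin
    refine nhdsWithin_le_nhds ?_
    have := Metric.ball_mem_nhds (0 : ℝ) (half_pos hs)
    filter_upwards [this] with t ht
    simpa using ht
  have hi : ∀ t : ℝ, |t| < s / 2 → ∀ β : Fin N → ℕ,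
      inner ℝ (hermiteE β) (t⁻¹ • (heatS N (s + t) u - heatS N s u)) =
        t⁻¹ * (Real.exp (-(eigenvalue β * (s + t))) - Real.exp (-(eigenvalue β * s))) *
          inner ℝ (hermiteE β) u := fun t ht β => by
    rw [real_inner_smul_right, inner_sub_right, inner_heatS hs.le,
      inner_heatS (by linarith [(abs_lt.1 ht).1])]
    ring
  -- For `|t| < s/2` the difference quotient of `exp(-λ s)` is at most `λ exp(-λ s/2) ≤ 2/s`, and
  -- the limit `λ exp(-λ s)` is at most `1/s`; both use `x exp(-x) ≤ 1`.
  refine tendsto_of_inner_hermiteE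
    ((hasSum_sq_inner_hermiteE u).summable.mul_left ((2 / s + 1 / s) ^ 2)) ?_ fun β => ?_
  · filter_upwards [hsmall] with t ht β
    have hl := eigenvalue_nonneg β
    have h1 : |t⁻¹ * (Real.exp (-(eigenvalue β * (s + t))) - Real.exp (-(eigenvalue β * s)))| ≤
        2 / s := by
      have e : Real.exp (-(eigenvalue β * (s + t))) - Real.exp (-(eigenvalue β * s)) =
          Real.exp (-(eigenvalue β * s)) * (Real.exp (-(eigenvalue β * t)) - 1) := by
        rw [mul_sub, ← Real.exp_add]
        congr 2
        · ring
        · ring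
      have h2 := abs_exp_sub_one_le_mul_exp (-(eigenvalue β * t))
      rw [abs_neg, abs_mul, abs_of_nonneg hl] at h2
      have ht0 : 0 < |t| := abs_pos.2 ht.2
      rw [e, abs_mul, abs_mul, abs_inv, Real.abs_exp, inv_mul_le_iff₀ ht0]
      have h3 : Real.exp (-(eigenvalue β * s)) * Real.exp (eigenvalue β * |t|) ≤
          Real.exp (-(eigenvalue β * (s / 2))) := by
        rw [← Real.exp_add, Real.exp_le_exp]
        nlinarith [ht.1]
      have h4 := mul_exp_neg_le_one (eigenvalue β * (s / 2))
      calc Real.exp (-(eigenvalue β * s)) * |Real.exp (-(eigenvalue β * t)) - 1|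
          ≤ Real.exp (-(eigenvalue β * s)) *
            (eigenvalue β * |t| * Real.exp (eigenvalue β * |t|)) := by gcongr
        _ = eigenvalue β * |t| *
            (Real.exp (-(eigenvalue β * s)) * Real.exp (eigenvalue β * |t|)) := by ring
        _ ≤ eigenvalue β * |t| * Real.exp (-(eigenvalue β * (s / 2))) := by gcongr
        _ = |t| * (2 / s * (eigenvalue β * (s / 2) * Real.exp (-(eigenvalue β * (s / 2))))) := by
            field_simp
        _ ≤ |t| * (2 / s * 1) := by gcongr
        _ = |t| * (2 / s) := by ring
    have h2 : |Real.exp (-(eigenvalue β * s)) * eigenvalue β| ≤ 1 / s := by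
      rw [abs_of_nonneg (mul_nonneg (Real.exp_pos _).le hl), le_div_iff₀ hs]
      linarith [mul_exp_neg_le_one (eigenvalue β * s)]
    rw [inner_sub_right, hi t ht.1, inner_neg_right, inner_heatG hs, sub_neg_eq_add, ← add_mul,
      mul_pow]
    refine mul_le_mul_of_nonneg_right ?_ (sq_nonneg _)
    rw [← sq_abs]
    exact pow_le_pow_left₀ (abs_nonneg _) ((abs_add_le _ _).trans (add_le_add h1 h2)) 2
  · rw [inner_neg_right, inner_heatG hs, ← neg_mul]
    have h := (hasDerivAt_iff_tendsto_slope_zero.1 (hasDerivAt_exp_neg_mul (eigenvalue β) s)).mul_const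
      (inner ℝ (hermiteE β) u)
    refine h.congr' ?_
    filter_upwards [hsmall] with t ht
    rw [hi t ht.1, smul_eq_mul]

theorem tendsto_inv_mul_exp_sub_one (c : ℝ) :
    Tendsto (fun h : ℝ => h⁻¹ * (Real.exp (-(c * h)) - 1)) (𝓝[>] 0) (𝓝 (-c)) := by
  have h := hasDerivAt_iff_tendsto_slope_zero.1 (hasDerivAt_exp_neg_mul c 0)
  simp only [mul_zero, neg_zero, Real.exp_zero, one_mul, zero_add, smul_eq_mul] at h
  exact h.mono_left (nhdsWithin_mono _ fun x hx => ne_of_gt hx)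

theorem inner_slope_heatS {N : ℕ} {h : ℝ} (hh : 0 ≤ h) (u : L2K N) (β : Fin N → ℕ) :
    inner ℝ (hermiteE β) (h⁻¹ • (heatS N h u - u)) =
      h⁻¹ * (Real.exp (-(eigenvalue β * h)) - 1) * inner ℝ (hermiteE β) u := by
  rw [real_inner_smul_right, inner_sub_right, inner_heatS hh]
  ring

theorem generator_heatS {N : ℕ} (u w : L2K N) :
    Tendsto (fun h : ℝ => h⁻¹ • (heatS N h u - u)) (𝓝[>] 0) (𝓝 w) ↔
      ∃ f, IsL u f ∧ w = -(f - ((N : ℝ) / 2) • u) := by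
  have hpos : ∀ᶠ h : ℝ in 𝓝[>] 0, 0 < h := self_mem_nhdsWithin
  constructor
  · intro hw
    have hc : ∀ β, inner ℝ (hermiteE β) w = -eigenvalue β * inner ℝ (hermiteE β) u := fun β => by
      refine tendsto_nhds_unique ((tendsto_const_nhds (x := hermiteE β)).inner hw)
        (((tendsto_inv_mul_exp_sub_one (eigenvalue β)).mul_const _).congr' ?_)
      filter_upwards [hpos] with h hh
      rw [inner_slope_heatS hh.le]
    -- Coefficientwise `w = -λ u`, so `u - 2 w` has coefficients `(1 + 2 λ) u_β`. Writing `u` as the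
    -- resolvent of an element of `L²(K)` places it in `H²(K)`.
    have hu : mulOp (fun β => (1 + 2 * eigenvalue β)⁻¹) (u - (2 : ℝ) • w) = u := by
      refine ext_inner_hermiteE fun β => ?_
      have := eigenvalue_nonneg β
      rw [inner_mulOp isBdd_resolvent, inner_sub_right, real_inner_smul_right, hc,
        inv_mul_eq_iff_eq_mul₀ (by positivity)]
      ring
    have hL := isL_mulOp isRegular_resolvent isBdd_resolvent_mul_eigenvalue (u - (2 : ℝ) • w)
    rw [hu] at hL
    refine ⟨_, hL, ext_inner_hermiteE fun β => ?_⟩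
    rw [inner_neg_right, inner_sub_right, real_inner_smul_right, hL.weakL.inner_hermiteE, hc]
    ring
  · rintro ⟨f, hf, rfl⟩
    have hc : ∀ β, inner ℝ (hermiteE β) (-(f - ((N : ℝ) / 2) • u)) =
        -eigenvalue β * inner ℝ (hermiteE β) u := fun β => by
      rw [inner_neg_right, inner_sub_right, real_inner_smul_right, hf.weakL.inner_hermiteE]
      ring
    -- With `x = λ h`, `0 ≤ exp(-x) - 1 + x ≤ x` bounds the error by `λ |u_β|`, the size of the
    -- coefficient of the limit itself, which is square summable.
    refine tendsto_of_inner_hermiteE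
      (hasSum_sq_inner_hermiteE (-(f - ((N : ℝ) / 2) • u))).summable ?_ fun β => ?_
    · filter_upwards [hpos] with h hh β
      have hl := eigenvalue_nonneg β
      have hx : 0 ≤ eigenvalue β * h := by positivity
      rw [inner_sub_right, inner_slope_heatS hh.le, hc, ← sub_mul, mul_pow, mul_pow]
      refine mul_le_mul_of_nonneg_right ?_ (sq_nonneg _)
      have h1 := Real.add_one_le_exp (-(eigenvalue β * h))
      have h2 : Real.exp (-(eigenvalue β * h)) ≤ 1 := by
        rw [Real.exp_le_one_iff]
        linarith
      rw [← sq_abs, ← sq_abs (-eigenvalue β), abs_neg, abs_of_nonneg hl]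
      refine pow_le_pow_left₀ (abs_nonneg _) ?_ 2
      have e : h⁻¹ * (Real.exp (-(eigenvalue β * h)) - 1) - -eigenvalue β =
          h⁻¹ * (Real.exp (-(eigenvalue β * h)) - 1 + eigenvalue β * h) := by
        field_simp
        ring
      rw [e, abs_of_nonneg (mul_nonneg (by positivity) (by linarith)), inv_mul_le_iff₀ hh]
      linarith
    · rw [hc]
      refine ((tendsto_inv_mul_exp_sub_one (eigenvalue β)).mul_const _).congr' ?_
      filter_upwards [hpos] with h hh
      rw [inner_slope_heatS hh.le]

theorem isHeatSemigroup_heatS (N : ℕ) : IsHeatSemigroup (heatS N) where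
  zero := heatS_zero N
  add _ _ := heatS_add
  continuousOn u := (continuous_heatS u).continuousOn
  contraction _ := norm_heatS_le
  generator := generator_heatS

/-! ### Smoothing -/

theorem contDiffOn_heatS {N : ℕ} (n : ℕ) (u : L2K N) :
    ContDiffOn ℝ n (fun s => heatS N s u) (Ioi 0) := by
  induction n generalizing u with
  | zero => exact contDiffOn_zero.2 (continuous_heatS u).continuousOn
  | succ n ih =>
    push_cast
    rw [contDiffOn_succ_iff_deriv_of_isOpen isOpen_Ioi]
    refine ⟨fun s hs => (hasDerivAt_heatS hs u).differentiableAt.differentiableWithinAt,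
      by simp, fun s hs => ?_⟩
    have hs' : (0 : ℝ) < s / 2 := half_pos hs
    -- Near `s` the derivative equals `-S(t - s/2)` applied to the fixed element `(L - N/2) S(s/2)
    -- u`, to which the induction hypothesis applies.
    have h1 : ContDiffAt ℝ n (fun t => heatS N t (heatG N (s / 2) u)) (s - s / 2) :=
      (ih _).contDiffAt (Ioi_mem_nhds (by linarith))
    have h2 : ContDiffAt ℝ n (fun t => -heatS N (t - s / 2) (heatG N (s / 2) u)) s :=
      (h1.comp s (contDiffAt_id.sub contDiffAt_const)).neg
    refine (h2.congr_of_eventuallyEq ?_).contDiffWithinAt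
    filter_upwards [Ioi_mem_nhds (show s / 2 < s by linarith [show (0 : ℝ) < s from hs])] with t ht
    have ht' : s / 2 < t := ht
    rw [(hasDerivAt_heatS (hs'.trans ht') u).deriv, heatS_heatG (by linarith) hs',
      sub_add_cancel]

theorem smoothInHK_heatS {N : ℕ} (m : ℕ) (u : L2K N) : SmoothInHK m fun s => heatS N s u := by
  classical
  refine ⟨fun s => if hs : 0 < s then sobolevOp (isRegular_exp m hs) u else 0, fun s hs => ?_,
    fun s hs => ?_⟩
  · have hs' : (0 : ℝ) < s / 2 := half_pos hs
    have h0 : ContDiffOn ℝ ∞ (fun s => heatS N s u) (Ioi 0) :=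
      contDiffOn_infty.2 fun n => contDiffOn_heatS n u
    have h1 : ContDiffAt ℝ ∞ (fun t => heatS N t u) (s - s / 2) :=
      h0.contDiffAt (Ioi_mem_nhds (by linarith))
    -- Splitting `S(t) = S(s/2) S(t - s/2)` leaves a fixed bounded operator into `H^m(K)` after an
    -- orbit already smooth in `L²(K)`.
    have h2 : ContDiffAt ℝ ∞ (fun t => sobolevOp (isRegular_exp m hs') (heatS N (t - s / 2) u)) s :=
      (sobolevOp (isRegular_exp m hs')).contDiff.contDiffAt.comp s
        (h1.comp s (contDiffAt_id.sub contDiffAt_const))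
    refine (h2.congr_of_eventuallyEq ?_).contDiffWithinAt
    filter_upwards [Ioi_mem_nhds (show s / 2 < s by linarith [show (0 : ℝ) < s from hs])] with t ht
    have ht' : s / 2 < t := ht
    rw [dif_pos (hs'.trans ht'), heatS_of_nonneg (by linarith)]
    refine (sobolevOp_mulOp _ (isBdd_exp (by linarith)) _ (fun β => ?_) u).symm
    rw [← Real.exp_add]
    congr 1
    ring
  · simp only [dif_pos hs]
    rw [toL2K_sobolevOp, heatS_of_nonneg hs.le]

/-! ### Conservation and decay -/

theorem inner_heatS_phiOne {N : ℕ} {s : ℝ} (hs : 0 ≤ s) (u : L2K N) :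
    inner ℝ (heatS N s u) (phiOne N) = inner ℝ u (phiOne N) := by
  rw [← hermiteE_zero, real_inner_comm, inner_heatS hs, real_inner_comm]
  simp [eigenvalue]

/-- The spectral gap: `λ_β = |β|/2 ≥ 1/2` unless `β = 0`, and the coefficient at `β = 0` is the one
along `φ₁`. -/
theorem norm_heatS_le_of_mem_orthogonal {N : ℕ} {u : L2K N} (hu : u ∈ (firstEigenspace N)ᗮ)
    {s : ℝ} (hs : 0 ≤ s) : ‖heatS N s u‖ ≤ Real.exp (-s / 2) * ‖u‖ := by
  refine norm_le_of_abs_inner_le (Real.exp_pos _).le fun β => ?_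
  rw [inner_heatS hs, abs_mul, Real.abs_exp]
  by_cases hβ : β = 0
  · have h0 : inner ℝ (hermiteE β) u = 0 := by
      rw [hβ, hermiteE_zero]
      exact (Submodule.mem_orthogonal _ _).1 hu _ (Submodule.mem_span_singleton_self _)
    simp [h0]
  · refine mul_le_mul_of_nonneg_right (Real.exp_le_exp.2 ?_) (abs_nonneg _)
    obtain ⟨i, hi⟩ := Function.ne_iff.1 hβ
    have h1 : (1 : ℝ) ≤ ∑ j, (β j : ℝ) := by
      have h2 : (1 : ℝ) ≤ β i := by exact_mod_cast Nat.one_le_iff_ne_zero.2 hi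
      exact h2.trans (Finset.single_le_sum (f := fun j => (β j : ℝ)) (fun j _ => by positivity)
        (Finset.mem_univ i))
    rw [eigenvalue]
    nlinarith

/-- `S(s) = S(1) S(s - 1)`: the last unit of time is spent on regularity, and the decay over `s - 1`
costs the factor `exp(1/2)`. -/
theorem exists_norm_sobolev_le (N m : ℕ) : ∃ C : ℝ, 0 < C ∧ ∀ u ∈ (firstEigenspace N)ᗮ,
    ∀ s, 1 ≤ s → ∃ V : HK N m, toL2K V = heatS N s u ∧ ‖V‖ ≤ C * Real.exp (-s / 2) * ‖u‖ := by
  have h1 := isRegular_exp (N := N) m one_pos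
  refine ⟨(‖sobolevOp h1‖ + 1) * Real.exp (1 / 2), by positivity, fun u hu s hs => ?_⟩
  have hs' : 0 ≤ s - 1 := by linarith
  refine ⟨sobolevOp h1 (heatS N (s - 1) u), ?_, ?_⟩
  · rw [toL2K_sobolevOp, ← heatS_of_nonneg zero_le_one, ← ContinuousLinearMap.comp_apply,
      ← heatS_add zero_le_one hs', add_sub_cancel]
  · calc ‖sobolevOp h1 (heatS N (s - 1) u)‖ ≤ ‖sobolevOp h1‖ * ‖heatS N (s - 1) u‖ :=
          ContinuousLinearMap.le_opNorm _ _
      _ ≤ (‖sobolevOp h1‖ + 1) * (Real.exp (-(s - 1) / 2) * ‖u‖) := by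
          gcongr
          · linarith
          · exact norm_heatS_le_of_mem_orthogonal hu hs'
      _ = _ := by
          rw [mul_assoc (_ + 1), mul_assoc (_ + 1), ← Real.exp_add]
          congr 3
          ring

theorem norm_heatG_le {N : ℕ} {s : ℝ} (hs : 0 < s) (u : L2K N) :
    ‖heatG N s u‖ ≤ 1 / (√2 * s) * ‖u‖ := by
  refine norm_le_of_abs_inner_le (by positivity) fun β => ?_
  rw [inner_heatG hs, abs_mul]
  refine mul_le_mul_of_nonneg_right ?_ (abs_nonneg _)
  rw [abs_of_nonneg (mul_nonneg (Real.exp_pos _).le (eigenvalue_nonneg β)),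
    le_div_iff₀ (by positivity)]
  -- The sharp maximum `x exp(-x) ≤ 1/e` suffices because `√2 ≤ 2 ≤ e`.
  have h1 := Real.mul_exp_neg_le_exp_neg_one (eigenvalue β * s)
  have h2 : √2 ≤ Real.exp 1 := by
    have h3 := Real.add_one_le_exp (1 : ℝ)
    have h4 : √2 ≤ 2 := by
      rw [Real.sqrt_le_left (by norm_num)]
      norm_num
    linarith
  have h3 : Real.exp 1 * Real.exp (-1) = 1 := by rw [← Real.exp_add]; simp
  calc Real.exp (-(eigenvalue β * s)) * eigenvalue β * (√2 * s)
      = √2 * (eigenvalue β * s * Real.exp (-(eigenvalue β * s))) := by ring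
    _ ≤ √2 * Real.exp (-1) := by gcongr
    _ ≤ Real.exp 1 * Real.exp (-1) := by gcongr
    _ = 1 := h3

theorem exists_gradient_heatS {N : ℕ} {s : ℝ} (hs : 0 < s) (u : L2K N) :
    ∃ g : Fin N → L2K N, (∀ i, HasWeakDeriv (Pi.single i 1) (heatS N s u) (g i)) ∧
      (∑ i, ‖g i‖ ^ 2) - (N : ℝ) / 2 * ‖heatS N s u‖ ^ 2 ≤ 1 / (2 * s) * ‖u‖ ^ 2 := by
  have hb := fun i : Fin N => isBdd_exp_mul_shiftFactor (α := Pi.single i 1) (sum_single i 1).le hs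
  refine ⟨fun i => shiftOp (Pi.single i 1)
    (fun β => Real.exp (-(eigenvalue β * s)) * shiftFactor (Pi.single i 1) β) u, fun i => ?_, ?_⟩
  · rw [heatS_of_nonneg hs.le]
    exact hasWeakDeriv_mulOp (isBdd_exp hs.le) (hb i) u
  · have h1 := (hasSum_sum fun i (_ : i ∈ Finset.univ) => 
      hasSum_sq_shiftOp (α := Pi.single i 1) (hb i) u).sub
      ((hasSum_sq_inner_hermiteE (heatS N s u)).mul_left ((N : ℝ) / 2))
    refine hasSum_le (fun β => ?_) h1 ((hasSum_sq_inner_hermiteE u).mul_left (1 / (2 * s)))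
    -- The energy identity per mode: the squared first-order shift factors `(β_i + 1)/2` sum to `λ_β
    -- + N/2`. Subtracting `N/2` leaves `λ exp(-2 λ s) ≤ 1/(2 s)`.
    have h2 : ∑ i, (Real.exp (-(eigenvalue β * s)) * shiftFactor (Pi.single i 1) β *
        inner ℝ (hermiteE β) u) ^ 2 = (eigenvalue β + (N : ℝ) / 2) *
        (Real.exp (-(eigenvalue β * s)) * inner ℝ (hermiteE β) u) ^ 2 := by
      have h3 : ∀ i, (Real.exp (-(eigenvalue β * s)) * shiftFactor (Pi.single i 1) β *
          inner ℝ (hermiteE β) u) ^ 2 = ((β i : ℝ) / 2 + 1 / 2) *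
          (Real.exp (-(eigenvalue β * s)) * inner ℝ (hermiteE β) u) ^ 2 := fun i => by
        rw [mul_pow, mul_pow, shiftFactor_single_sq]
        ring
      rw [Finset.sum_congr rfl fun i _ => h3 i, ← Finset.sum_mul, Finset.sum_add_distrib,
        ← Finset.sum_div, eigenvalue]
      simp [div_eq_mul_inv]
    rw [h2, inner_heatS hs.le, ← sub_mul, add_sub_cancel_right, mul_pow, ← mul_assoc]
    refine mul_le_mul_of_nonneg_right ?_ (sq_nonneg _)
    have h4 := mul_exp_neg_le_one (2 * (eigenvalue β * s))
    rw [← Real.exp_nat_mul, le_div_iff₀ (by positivity)]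
    push_cast
    rw [mul_neg]
    linarith

/-! ### Space-time test functions -/

/-- The time derivative of a function on space-time. -/
noncomputable def timeD {N : ℕ} (φ : ℝ → Space N → ℝ) (s : ℝ) (y : Space N) : ℝ :=
  deriv (fun σ => φ σ y) s

theorem hasDerivAt_timeD {N : ℕ} {φ : ℝ → Space N → ℝ} (h : ContDiff ℝ ∞ (Function.uncurry φ))
    (s : ℝ) (y : Space N) :
    HasDerivAt (fun σ => φ σ y) (fderiv ℝ (Function.uncurry φ) (s, y) (1, 0)) s := by
  have h1 : HasDerivAt (fun σ : ℝ => (σ, y)) ((1 : ℝ), (0 : Space N)) s :=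
    (hasDerivAt_id s).prodMk (hasDerivAt_const s y)
  exact (h.differentiable (by simp) (s, y)).hasFDerivAt.comp_hasDerivAt s h1

theorem uncurry_timeD {N : ℕ} {φ : ℝ → Space N → ℝ} (h : ContDiff ℝ ∞ (Function.uncurry φ)) :
    Function.uncurry (timeD φ) = fun p => fderiv ℝ (Function.uncurry φ) p (1, 0) := by
  funext ⟨s, y⟩
  exact (hasDerivAt_timeD h s y).deriv

theorem timeD_smooth {N : ℕ} {φ : ℝ → Space N → ℝ}
    (h : ContDiff ℝ ∞ (Function.uncurry φ) ∧ HasCompactSupport (Function.uncurry φ)) :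
    ContDiff ℝ ∞ (Function.uncurry (timeD φ)) ∧
      HasCompactSupport (Function.uncurry (timeD φ)) := by
  rw [uncurry_timeD h.1]
  exact ⟨(h.1.fderiv_right (m := ∞) (by simp)).clm_apply contDiff_const, h.2.fderiv_apply ℝ _⟩

theorem tsupport_timeD_subset {N : ℕ} {φ : ℝ → Space N → ℝ}
    (h : ContDiff ℝ ∞ (Function.uncurry φ)) :
    tsupport (Function.uncurry (timeD φ)) ⊆ tsupport (Function.uncurry φ) := by
  rw [uncurry_timeD h]
  refine (closure_mono fun p hp => ?_).trans (tsupport_fderiv_subset ℝ (f := Function.uncurry φ))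
  rw [Function.mem_support] at hp ⊢
  intro h0
  rw [h0] at hp
  exact hp rfl

theorem slice_smooth {N : ℕ} {φ : ℝ → Space N → ℝ}
    (h : ContDiff ℝ ∞ (Function.uncurry φ) ∧ HasCompactSupport (Function.uncurry φ)) (s : ℝ) :
    ContDiff ℝ ∞ (φ s) ∧ HasCompactSupport (φ s) := by
  refine ⟨h.1.comp (contDiff_prodMk_right s), HasCompactSupport.intro (h.2.image continuous_snd)
    fun y hy => ?_⟩
  by_contra h0
  exact hy ⟨(s, y), subset_closure h0, rfl⟩

theorem slice_eq_zero {N : ℕ} {φ : ℝ → Space N → ℝ} {s : ℝ}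
    (hs : s ∉ Prod.fst '' tsupport (Function.uncurry φ)) (y : Space N) : φ s y = 0 := by
  by_contra h0
  exact hs ⟨(s, y), subset_closure h0, rfl⟩

/-- The time derivative is globally Lipschitz by compact support, so the remainder is quadratic
uniformly in `y`. Uniformity gives differentiability in `L²(K)`. -/
theorem exists_taylor_bound {N : ℕ} {φ : ℝ → Space N → ℝ}
    (h : ContDiff ℝ ∞ (Function.uncurry φ) ∧ HasCompactSupport (Function.uncurry φ)) :
    ∃ M : ℝ, 0 ≤ M ∧ ∀ s t y, |φ t y - φ s y - (t - s) * timeD φ s y| ≤ M * |t - s| ^ 2 := by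
  have h' := timeD_smooth h
  obtain ⟨M, hM⟩ := ContDiff.lipschitzWith_of_hasCompactSupport h'.2 h'.1 (by simp)
  refine ⟨M, M.2, fun s t y => ?_⟩
  have hd : ∀ r, HasDerivAt (fun r => φ r y - r * timeD φ s y) (timeD φ r y - timeD φ s y) r :=
    fun r => by
      have h1 := hasDerivAt_timeD h.1 r y
      rw [← h1.deriv] at h1
      have h2 := h1.sub ((hasDerivAt_id r).mul_const (timeD φ s y))
      simp only [id_eq, one_mul] at h2
      exact h2
  have h3 := Convex.norm_image_sub_le_of_norm_deriv_le (𝕜 := ℝ) (s := uIcc s t) (x := s) (y := t)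
    (C := M * |t - s|) (fun r _ => (hd r).differentiableAt) (fun r hr => ?_) (convex_uIcc s t)
    left_mem_uIcc right_mem_uIcc
  · rw [Real.norm_eq_abs, Real.norm_eq_abs] at h3
    convert! h3 using 1
    · congr 1
      ring
    · ring
  · rw [(hd r).deriv]
    have h4 := hM.dist_le_mul (r, y) (s, y)
    rw [Real.dist_eq, Prod.dist_eq, dist_self, max_eq_left dist_nonneg, Real.dist_eq] at h4
    refine h4.trans (mul_le_mul_of_nonneg_left ?_ M.2)
    exact abs_sub_left_of_mem_uIcc hr

/-- The element of `L²(K)` that represents the pairing with the slice `φ s`. -/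
noncomputable def sliceDual {N : ℕ} {φ : ℝ → Space N → ℝ}
    (h : ContDiff ℝ ∞ (Function.uncurry φ) ∧ HasCompactSupport (Function.uncurry φ)) (s : ℝ) :
    L2K N := (ExpBdd.of_test (slice_smooth h s)).dual

theorem hasDerivAt_sliceDual {N : ℕ} {φ : ℝ → Space N → ℝ}
    (h : ContDiff ℝ ∞ (Function.uncurry φ) ∧ HasCompactSupport (Function.uncurry φ)) (s : ℝ) :
    HasDerivAt (sliceDual h) (sliceDual (timeD_smooth h) s) s := by
  obtain ⟨M, hM, hb⟩ := exists_taylor_bound h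
  rw [hasDerivAt_iff_isLittleO]
  refine Asymptotics.IsBigO.trans_isLittleO (g := fun t : ℝ => ‖t - s‖ ^ 2) ?_
    (Asymptotics.isLittleO_pow_sub_sub s one_lt_two)
  -- The remainder is pointwise at most `M |t - s|² / K`, and `1 / K` lies in `L²(K)`.
  refine Asymptotics.IsBigO.of_bound (M * ‖(ExpBdd.const (N := N) 1).dual‖)
    (Eventually.of_forall fun t => ?_)
  rw [norm_pow, norm_norm, mul_right_comm]
  refine Lp.norm_le_mul_norm_of_ae_le_mul (ae_weightMeasure_iff.2 ?_)
  filter_upwards [ae_weightMeasure_iff.1 (Lp.coeFn_sub (sliceDual h t - sliceDual h s)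
      ((t - s) • sliceDual (timeD_smooth h) s)),
    ae_weightMeasure_iff.1 (Lp.coeFn_sub (sliceDual h t) (sliceDual h s)),
    ae_weightMeasure_iff.1 (Lp.coeFn_smul (t - s) (sliceDual (timeD_smooth h) s)),
    (ExpBdd.of_test (slice_smooth h t)).coeFn_dual, (ExpBdd.of_test (slice_smooth h s)).coeFn_dual,
    (ExpBdd.of_test (slice_smooth (timeD_smooth h) s)).coeFn_dual,
    (ExpBdd.const (N := N) 1).coeFn_dual] with y h1 h2 h3 h4 h5 h6 h7
  rw [h1, Pi.sub_apply, h2, Pi.sub_apply, h3, Pi.smul_apply, h7, sliceDual, sliceDual, sliceDual, h4,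
    h5, h6, smul_eq_mul]
  have hw := weight_pos N y
  rw [← sub_div, ← mul_div_assoc, ← sub_div, Real.norm_eq_abs, Real.norm_eq_abs, Real.norm_eq_abs,
    abs_div, abs_of_pos hw, abs_of_pos (by positivity : 0 < 1 / weight N y), ← mul_div_assoc, mul_one]
  gcongr
  exact hb s t y

theorem continuous_sliceDual {N : ℕ} {φ : ℝ → Space N → ℝ}
    (h : ContDiff ℝ ∞ (Function.uncurry φ) ∧ HasCompactSupport (Function.uncurry φ)) :
    Continuous (sliceDual h) :=
  continuous_iff_continuousAt.2 fun s => (hasDerivAt_sliceDual h s).continuousAt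

theorem sliceDual_eq_zero {N : ℕ} {φ : ℝ → Space N → ℝ}
    (h : ContDiff ℝ ∞ (Function.uncurry φ) ∧ HasCompactSupport (Function.uncurry φ)) {s : ℝ}
    (hs : s ∉ Prod.fst '' tsupport (Function.uncurry φ)) : sliceDual h s = 0 := by
  rw [Lp.eq_zero_iff_ae_eq_zero]
  refine ae_weightMeasure_iff.2 ?_
  filter_upwards [(ExpBdd.of_test (slice_smooth h s)).coeFn_dual] with y hy
  rw [sliceDual, hy, slice_eq_zero hs, zero_div, Pi.zero_apply]

theorem continuousOn_heatG {N : ℕ} (u : L2K N) : ContinuousOn (fun s => heatG N s u) (Ioi 0) := by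
  have h := ((contDiffOn_heatS 1 u).continuousOn_deriv_of_isOpen isOpen_Ioi (by simp)).neg
  refine h.congr fun s hs => ?_
  simp [(hasDerivAt_heatS hs u).deriv]

/-- Moving `L` from the test function to `S(s) u` turns the spatial integral into minus the time
derivative of `∫ S(s) u φ(s) dy`. -/
theorem integral_heatS_mul {N : ℕ} {φ : ℝ → Space N → ℝ}
    (h : ContDiff ℝ ∞ (Function.uncurry φ) ∧ HasCompactSupport (Function.uncurry φ)) (u : L2K N)
    {s : ℝ} (hs : 0 < s) :
    ∫ y, heatS N s u y * (-deriv (fun σ => φ σ y) s - (Δ (φ s)) y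
        + (N * φ s y + fderiv ℝ (φ s) y y) / 2 - N / 2 * φ s y) =
      -(inner ℝ (sliceDual h s) (-heatG N s u) +
        inner ℝ (sliceDual (timeD_smooth h) s) (heatS N s u)) := by
  have hφ := slice_smooth h s
  have e1 : ∀ y, heatS N s u y * (-deriv (fun σ => φ σ y) s - (Δ (φ s)) y
        + (N * φ s y + fderiv ℝ (φ s) y y) / 2 - N / 2 * φ s y) =
      heatS N s u y * adjointL (φ s) y - heatS N s u y * timeD φ s y -
        N / 2 * (heatS N s u y * φ s y) := fun y => by
    rw [adjointL, timeD]
    ring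
  have i1 := (ExpBdd.adjointL_of_test hφ).integrable_mul (heatS N s u)
  have i2 := (ExpBdd.of_test (slice_smooth (timeD_smooth h) s)).integrable_mul (heatS N s u)
  have i3 := (ExpBdd.of_test hφ).integrable_mul (heatS N s u)
  have i12 : Integrable fun y => heatS N s u y * adjointL (φ s) y -
      heatS N s u y * timeD φ s y := i1.sub i2
  simp only [e1]
  rw [integral_sub i12 (i3.const_mul _), integral_sub i1 i2, integral_const_mul,
    (isL_heatS hs u).weakL _ hφ.1 hφ.2, ← (ExpBdd.of_test hφ).inner_dual,
    ← (ExpBdd.of_test hφ).inner_dual,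
    ← (ExpBdd.of_test (slice_smooth (timeD_smooth h) s)).inner_dual, inner_add_right,
    real_inner_smul_right, inner_neg_right, sliceDual, sliceDual]
  ring

theorem isSolution_heatS {N : ℕ} (u : L2K N) : IsSolution u fun s => heatS N s u where
  continuousOn := (continuous_heatS u).continuousOn
  initial := by rw [heatS_zero]; rfl
  equation φ h1 h2 h3 := by
    have h := And.intro h1 h2
    set T := Prod.fst '' tsupport (Function.uncurry φ) with hT
    have hTc : IsCompact T := h2.image continuous_fst
    have hT0 : T ⊆ Ioi 0 := by
      rintro _ ⟨p, hp, rfl⟩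
      exact (h3 hp).1
    have hT' : Prod.fst '' tsupport (Function.uncurry (timeD φ)) ⊆ T :=
      image_mono (tsupport_timeD_subset h1)
    have hF : Continuous fun s => inner ℝ (sliceDual h s) (heatS N s u) :=
      (continuous_sliceDual h).inner (continuous_heatS u)
    have hF0 : ∀ s ∉ T, inner ℝ (sliceDual h s) (heatS N s u) = 0 := fun s hs => by
      rw [sliceDual_eq_zero h hs, inner_zero_left]
    -- The fundamental theorem of calculus on the half-line; the pairing vanishes at `0` and for
    -- large times. Integrability is checked only on the compact set `T` of times inside `(0,∞)`,
    -- which avoids any singularity of the derivative at `s = 0`.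
    rw [setIntegral_congr_fun measurableSet_Ioi fun s hs => integral_heatS_mul h u hs, integral_neg,
      integral_Ioi_of_hasDerivAt_of_tendsto (m := 0) hF.continuousWithinAt
        (fun s hs => (hasDerivAt_sliceDual h s).inner ℝ (hasDerivAt_heatS hs u)) ?_ ?_,
      hF0 0 fun h0 => lt_irrefl (0 : ℝ) (hT0 h0)]
    · simp
    · refine IntegrableOn.of_forall_sdiff_eq_zero (s := T) ?_ measurableSet_Ioi fun s hs => ?_
      · refine ContinuousOn.integrableOn_compact hTc ?_
        exact (((continuous_sliceDual h).continuousOn.inner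
          ((continuousOn_heatG u).mono hT0).neg).add
          ((continuous_sliceDual (timeD_smooth h)).continuousOn.inner
            (continuous_heatS u).continuousOn))
      · rw [sliceDual_eq_zero h hs.2, sliceDual_eq_zero (timeD_smooth h) fun h0 => hs.2 (hT' h0)]
        simp
    · obtain ⟨b, hb⟩ := hTc.bddAbove
      refine tendsto_const_nhds.congr' ?_
      filter_upwards [eventually_gt_atTop b] with s hs
      exact (hF0 s fun h0 => absurd (hb h0) (not_le.2 hs)).symm

/-! ### Distributions with vanishing derivative -/

/-- The primitive from `0` vanishes to the left of the support, and to the right of it because the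
total integral is zero. -/
theorem exists_antiderivative_of_integral_eq_zero {k : ℝ → ℝ} (hk : ContDiff ℝ ∞ k)
    (hc : HasCompactSupport k) (hs : tsupport k ⊆ Ioi 0) (h0 : ∫ x, k x = 0) :
    ∃ θ : ℝ → ℝ, ContDiff ℝ ∞ θ ∧ HasCompactSupport θ ∧ tsupport θ ⊆ Ioi 0 ∧ deriv θ = k := by
  rcases (tsupport k).eq_empty_or_nonempty with he | hne
  · refine ⟨0, contDiff_const, HasCompactSupport.zero, by simp [tsupport], ?_⟩
    rw [tsupport_eq_empty_iff.1 he]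
    funext x
    simp
  obtain ⟨a, ha⟩ := hc.exists_isLeast hne
  obtain ⟨b, hb⟩ := hc.exists_isGreatest hne
  have ha0 : 0 < a := hs ha.1
  have hk0 : ∀ x, k x ≠ 0 → a ≤ x ∧ x ≤ b := fun x hx =>
    ⟨ha.2 (subset_closure hx), hb.2 (subset_closure hx)⟩
  have hd : ∀ x, HasDerivAt (fun s => ∫ x in (0 : ℝ)..s, k x) (k x) x := fun x =>
    (hk.continuous.integral_hasStrictDerivAt 0 x).hasDerivAt
  have hderiv : deriv (fun s => ∫ x in (0 : ℝ)..s, k x) = k := funext fun x => (hd x).deriv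
  have hsupp : tsupport (fun s => ∫ x in (0 : ℝ)..s, k x) ⊆ Icc a b := by
    refine closure_minimal (fun s hs => ?_) isClosed_Icc
    by_contra hn
    refine hs ?_
    rw [mem_Icc, not_and_or, not_le, not_le] at hn
    rcases hn with hn | hn
    · refine intervalIntegral.integral_zero_ae (Eventually.of_forall fun x hx => ?_)
      by_contra hx0
      have h1 := (hk0 x hx0).1
      have h2 : x ≤ max 0 s := hx.2
      rcases le_max_iff.1 h2 with h3 | h3 <;> linarith
    · rw [← h0]
      refine intervalIntegral.integral_eq_integral_of_support_subset fun x hx => ?_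
      have h1 := hk0 x hx
      exact ⟨by linarith, by linarith⟩
  refine ⟨_, ?_, isCompact_Icc.of_isClosed_subset (isClosed_tsupport _) hsupp, hsupp.trans fun x hx => ha0.trans_le hx.1,
    hderiv⟩
  · rw [contDiff_infty_iff_deriv, hderiv]
    exact ⟨fun x => (hd x).differentiableAt, hk⟩

/-- The du Bois-Reymond lemma: with `η` of integral one, `ψ - (∫ ψ) η` is the derivative of a test
function, so `g` pairs with `ψ` as the constant `∫ η g` does. -/
theorem eqOn_const_of_integral_deriv_mul_eq_zero {g : ℝ → ℝ} (hg : ContinuousOn g (Ioi 0))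
    (h : ∀ θ : ℝ → ℝ, ContDiff ℝ ∞ θ → HasCompactSupport θ → tsupport θ ⊆ Ioi 0 →
      ∫ s in Ioi (0 : ℝ), deriv θ s * g s = 0) : ∃ c, EqOn g (fun _ => c) (Ioi 0) := by
  let b : ContDiffBump (1 : ℝ) := ⟨1 / 4, 1 / 2, by norm_num, by norm_num⟩
  set η := b.normed volume with hη
  have hη1 : ContDiff ℝ ∞ η := b.contDiff_normed
  have hη2 : HasCompactSupport η := b.hasCompactSupport_normed
  have hη3 : tsupport η ⊆ Ioi 0 := by
    rw [hη, b.tsupport_normed_eq]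
    intro x hx
    rw [Metric.mem_closedBall, Real.dist_eq] at hx
    have h1 : -(1 / 2) ≤ x - 1 := (abs_le.1 hx).1
    rw [mem_Ioi]
    linarith
  have hη4 : ∫ x, η x = 1 := b.integral_normed
  have hint : ∀ {ψ : ℝ → ℝ}, Continuous ψ → HasCompactSupport ψ → tsupport ψ ⊆ Ioi 0 →
      IntegrableOn (fun s => ψ s * g s) (Ioi 0) := fun {ψ} h1 h2 h3 => by
    refine IntegrableOn.of_forall_sdiff_eq_zero (s := tsupport ψ)
      ((h1.continuousOn.mul (hg.mono h3)).integrableOn_compact h2) measurableSet_Ioi fun s hs => ?_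
    rw [image_eq_zero_of_notMem_tsupport hs.2, zero_mul]
  have hIoi : ∀ {f : ℝ → ℝ}, tsupport f ⊆ Ioi 0 → ∫ x in Ioi 0, f x = ∫ x, f x := fun {f} h1 =>
    setIntegral_eq_integral_of_forall_compl_eq_zero fun x hx =>
      image_eq_zero_of_notMem_tsupport fun h2 => hx (h1 h2)
  refine ⟨∫ s in Ioi (0 : ℝ), η s * g s, ?_⟩
  set c := ∫ s in Ioi (0 : ℝ), η s * g s with hc
  have hae : ∀ᵐ x, x ∈ Ioi (0 : ℝ) → g x - c = 0 := by
    refine isOpen_Ioi.ae_eq_zero_of_integral_contDiff_smul_eq_zero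
      ((hg.sub continuousOn_const).locallyIntegrableOn measurableSet_Ioi) fun ψ h1 h2 h3 => ?_
    have hIψ : Integrable ψ := h1.continuous.integrable_of_hasCompactSupport h2
    have hIη : Integrable η := hη1.continuous.integrable_of_hasCompactSupport hη2
    obtain ⟨θ, t1, t2, t3, t4⟩ := exists_antiderivative_of_integral_eq_zero
      (k := fun x => ψ x - (∫ x, ψ x) * η x) (h1.sub (contDiff_const.mul hη1))
      (h2.sub hη2.mul_left) (by
        refine (tsupport_sub _ _).trans (union_subset h3 ?_)
        exact (tsupport_mul_subset_right).trans hη3) (by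
        rw [integral_sub hIψ (hIη.const_mul _), integral_const_mul, hη4, mul_one, sub_self])
    have h4 := h θ t1 t2 t3
    rw [t4] at h4
    have i1 := hint h1.continuous h2 h3
    have i2 := hint hη1.continuous hη2 hη3
    simp only [sub_mul, mul_assoc] at h4
    rw [integral_sub i1 (i2.const_mul _), integral_const_mul, ← hc] at h4
    have h5 : ∫ x, ψ x • (g x - c) = ∫ x in Ioi 0, ψ x • (g x - c) := by
      refine (setIntegral_eq_integral_of_forall_compl_eq_zero fun x hx => ?_).symm
      rw [image_eq_zero_of_notMem_tsupport fun h2 => hx (h3 h2), zero_smul]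
    rw [h5]
    simp only [smul_eq_mul, mul_sub]
    rw [integral_sub i1 (hIψ.integrableOn.mul_const _), integral_mul_const, hIoi h3]
    exact h4
  refine Measure.eqOn_open_of_ae_eq (μ := volume) ?_ isOpen_Ioi hg continuousOn_const
  rw [EventuallyEq, ae_restrict_iff' measurableSet_Ioi]
  filter_upwards [hae] with x hx hx0
  linarith [hx hx0]

/-! ### Uniqueness -/

theorem laplacian_const_mul {N : ℕ} (c : ℝ) {ψ : Space N → ℝ} (h : ContDiff ℝ ∞ ψ) (y : Space N) :
    (Δ fun y => c * ψ y) y = c * (Δ ψ) y :=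
  InnerProductSpace.laplacian_smul c (contDiff_infty.1 h 2).contDiffAt

theorem IsSolution.integral_eq_zero {N : ℕ} {u : L2K N} {w : ℝ → L2K N} (hw : IsSolution u w)
    {θ : ℝ → ℝ} (t1 : ContDiff ℝ ∞ θ) (t2 : HasCompactSupport θ) (t3 : tsupport θ ⊆ Ioi 0)
    {ψ : Space N → ℝ} (hψ : ContDiff ℝ ∞ ψ ∧ HasCompactSupport ψ) :
    ∫ s in Ioi (0 : ℝ), (-(deriv θ s * inner ℝ (ExpBdd.of_test hψ).dual (w s)) +
      θ s * inner ℝ (ExpBdd.adjointL_of_test hψ).dual (w s) -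
      N / 2 * (θ s * inner ℝ (ExpBdd.of_test hψ).dual (w s))) = 0 := by
  have hsub : tsupport (Function.uncurry fun s y => θ s * ψ y) ⊆ tsupport θ ×ˢ tsupport ψ := by
    refine closure_minimal (fun p hp => ?_)
      ((isClosed_tsupport θ).prod (isClosed_tsupport ψ))
    have hp' : θ p.1 * ψ p.2 ≠ 0 := hp
    exact ⟨subset_closure (left_ne_zero_of_mul hp'), subset_closure (right_ne_zero_of_mul hp')⟩
  have h := hw.equation (fun s y => θ s * ψ y)
    ((t1.comp contDiff_fst).mul (hψ.1.comp contDiff_snd))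
    ((t2.prod hψ.2).of_isClosed_subset (isClosed_tsupport _) hsub)
    (hsub.trans (prod_mono t3 (subset_univ _)))
  refine Eq.trans ?_ h
  refine setIntegral_congr_fun measurableSet_Ioi fun s _ => ?_
  have e : ∀ y, w s y * (-deriv (fun σ => θ σ * ψ y) s - (Δ fun y => θ s * ψ y) y
      + (N * (θ s * ψ y) + fderiv ℝ (fun y => θ s * ψ y) y y) / 2 - N / 2 * (θ s * ψ y)) =
      -(deriv θ s * (w s y * ψ y)) + θ s * (w s y * adjointL ψ y) -
        N / 2 * (θ s * (w s y * ψ y)) := fun y => by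
    rw [laplacian_const_mul _ hψ.1, fderiv_const_mul (hψ.1.differentiable (by simp) y),
      deriv_mul_const (t1.differentiable (by simp) s), smul_apply, adjointL, smul_eq_mul]
    ring
  have i1 := (ExpBdd.of_test hψ).integrable_mul (w s)
  have i2 := (ExpBdd.adjointL_of_test hψ).integrable_mul (w s)
  have i3 : Integrable fun y => -(deriv θ s * (w s y * ψ y)) := (i1.const_mul _).neg
  have i4 : Integrable fun y => -(deriv θ s * (w s y * ψ y)) + θ s * (w s y * adjointL ψ y) :=
    i3.add (i2.const_mul _)
  simp only [e]
  rw [integral_sub i4 ((i1.const_mul _).const_mul _),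
    integral_add i3 (i2.const_mul _), integral_neg, integral_const_mul, integral_const_mul,
    integral_const_mul, integral_const_mul, ExpBdd.inner_dual, ExpBdd.inner_dual]

/-- The time average `∫ θ w` lies in `L²(K)` and satisfies a stationary weak equation, with `∫ θ' w`
on the right. Hermite polynomials are thus admitted by the stationary cutoff argument, with no
cutoff in space-time. -/
theorem IsSolution.integral_deriv_mul_inner {N : ℕ} {u : L2K N} {w : ℝ → L2K N}
    (hw : IsSolution u w) {θ : ℝ → ℝ} (t1 : ContDiff ℝ ∞ θ) (t2 : HasCompactSupport θ)
    (t3 : tsupport θ ⊆ Ioi 0) (β : Fin N → ℕ) :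
    IntegrableOn (fun s => deriv θ s * inner ℝ (hermiteE β) (w s)) (Ioi 0) ∧
    IntegrableOn (fun s => θ s * inner ℝ (hermiteE β) (w s)) (Ioi 0) ∧
    ∫ s in Ioi (0 : ℝ), deriv θ s * inner ℝ (hermiteE β) (w s) =
      eigenvalue β * ∫ s in Ioi (0 : ℝ), θ s * inner ℝ (hermiteE β) (w s) := by
  have hint : ∀ {f : ℝ → ℝ}, Continuous f → tsupport f ⊆ tsupport θ →
      IntegrableOn (fun s => f s • w s) (Ioi 0) := fun {f} h1 h2 => by
    refine IntegrableOn.of_forall_sdiff_eq_zero (s := tsupport θ)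
      (ContinuousOn.integrableOn_compact t2 (h1.continuousOn.smul (hw.continuousOn.mono
        (t3.trans Ioi_subset_Ici_self)))) measurableSet_Ioi fun s hs => ?_
    rw [image_eq_zero_of_notMem_tsupport fun h => hs.2 (h2 h), zero_smul]
  have i1 := hint (t1.continuous_deriv (by simp)) (tsupport_deriv_subset (f := θ))
  have i2 := hint t1.continuous subset_rfl
  have hL : WeakL (∫ s in Ioi (0 : ℝ), θ s • w s)
      ((∫ s in Ioi (0 : ℝ), deriv θ s • w s) +
        ((N : ℝ) / 2) • ∫ s in Ioi (0 : ℝ), θ s • w s) := by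
    rw [weakL_iff]
    intro ψ hψ
    have h := hw.integral_eq_zero t1 t2 t3 hψ
    have j1 := i1.const_inner (𝕜 := ℝ) (ExpBdd.of_test hψ).dual
    have j2 := i2.const_inner (𝕜 := ℝ) (ExpBdd.of_test hψ).dual
    have j3 := i2.const_inner (𝕜 := ℝ) (ExpBdd.adjointL_of_test hψ).dual
    rw [inner_add_right, real_inner_smul_right, ← integral_inner i1, ← integral_inner i2,
      ← integral_inner i2]
    simp only [real_inner_smul_right] at j1 j2 j3 ⊢
    have j1' := j1.neg
    simp only [Pi.neg_def] at j1'
    have j4 : IntegrableOn (fun s => -(deriv θ s * inner ℝ (ExpBdd.of_test hψ).dual (w s)) +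
        θ s * inner ℝ (ExpBdd.adjointL_of_test hψ).dual (w s)) (Ioi 0) := j1'.add j3
    rw [integral_sub j4 (j2.const_mul _), integral_add j1' j3, integral_neg,
      integral_const_mul] at h
    linarith
  have hc := hL.inner_hermiteE β
  have j1 := i1.const_inner (𝕜 := ℝ) (hermiteE β)
  have j2 := i2.const_inner (𝕜 := ℝ) (hermiteE β)
  rw [inner_add_right, real_inner_smul_right, ← integral_inner i1, ← integral_inner i2] at hc
  simp only [real_inner_smul_right] at j1 j2 hc
  exact ⟨j1, j2, by linarith⟩

theorem IsSolution.inner_eq {N : ℕ} {u : L2K N} {w : ℝ → L2K N} (hw : IsSolution u w)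
    (β : Fin N → ℕ) {s : ℝ} (hs : 0 ≤ s) :
    inner ℝ (hermiteE β) (w s) = Real.exp (-(eigenvalue β * s)) * inner ℝ (hermiteE β) u := by
  set g : ℝ → ℝ := fun s => Real.exp (eigenvalue β * s) * inner ℝ (hermiteE β) (w s) with hg
  have hgc : ContinuousOn g (Ici 0) :=
    (by fun_prop : Continuous fun s => Real.exp (eigenvalue β * s)).continuousOn.mul
      (continuousOn_const.inner hw.continuousOn)
  -- The integrating factor goes into the test function: the weak equation for the coefficient is
  -- used with `θ(s) exp(λ s)`.
  obtain ⟨c, hc⟩ := eqOn_const_of_integral_deriv_mul_eq_zero (hgc.mono Ioi_subset_Ici_self)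
    fun θ t1 t2 t3 => by
      have hexp : ContDiff ℝ ∞ fun s : ℝ => Real.exp (eigenvalue β * s) :=
        (contDiff_const.mul contDiff_id).exp
      have hd : ∀ s, deriv (fun s => θ s * Real.exp (eigenvalue β * s)) s =
          deriv θ s * Real.exp (eigenvalue β * s) +
            eigenvalue β * (θ s * Real.exp (eigenvalue β * s)) := fun s => by
        have h1 : HasDerivAt (fun s : ℝ => Real.exp (eigenvalue β * s))
            (Real.exp (eigenvalue β * s) * eigenvalue β) s := by
          simpa using ((hasDerivAt_id s).const_mul (eigenvalue β)).exp
        exact ((t1.differentiable (by simp) s).hasDerivAt.mul h1).deriv.trans (by ring)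
      obtain ⟨k1, k2, k3⟩ := hw.integral_deriv_mul_inner (t1.mul hexp) t2.mul_right
        (tsupport_mul_subset_left.trans t3) β
      have e : ∀ s, deriv θ s * g s =
          deriv (fun s => θ s * Real.exp (eigenvalue β * s)) s * inner ℝ (hermiteE β) (w s) -
          eigenvalue β * (θ s * Real.exp (eigenvalue β * s) * inner ℝ (hermiteE β) (w s)) :=
        fun s => by
          rw [hd, hg]
          ring
      simp only [e]
      rw [integral_sub k1 (k2.const_mul _), integral_const_mul, k3, sub_self]
  -- Continuity of `w` up to `s = 0` extends the constancy to the initial time, where the constant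
  -- is the coefficient of the initial datum.
  have hc' : EqOn g (fun _ => c) (Ici 0) := by
    rw [← closure_Ioi]
    exact hc.of_subset_closure (by rwa [closure_Ioi]) continuousOn_const subset_closure subset_rfl
  have h1 := (hc' hs).trans (hc' self_mem_Ici).symm
  simp only [hg, mul_zero, Real.exp_zero, one_mul, hw.initial] at h1
  rw [← h1, ← mul_assoc, ← Real.exp_add]
  simp

theorem IsSolution.eq_heatS {N : ℕ} {u : L2K N} {w : ℝ → L2K N} (hw : IsSolution u w) {s : ℝ}
    (hs : 0 ≤ s) : w s = heatS N s u :=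
  ext_inner_hermiteE fun β => by rw [hw.inner_eq β hs, inner_heatS hs]

end SimilarityHeat

/-! ### The main theorem -/

open SimilarityHeat in
theorem theorem3p2 (N : ℕ) (hN : 1 ≤ N) :
    ∃ S : ℝ → L2K N →L[ℝ] L2K N,
      IsHeatSemigroup S ∧
      -- (i)
      (∀ u₀ : L2K N,
        IsSolution u₀ (fun s => S s u₀) ∧
        (∀ w : ℝ → L2K N, IsSolution u₀ w → ∀ s, 0 ≤ s → w s = S s u₀) ∧
        (∀ m : ℕ, SmoothInHK m (fun s => S s u₀)) ∧
        (∀ s, 0 < s → ∃ f : L2K N, IsL (S s u₀) f ∧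
          HasDerivAt (fun σ => S σ u₀) (-(f - ((N : ℝ) / 2) • S s u₀)) s)) ∧
      -- (ii)
      (∀ u₀ : L2K N, ∀ s, 0 ≤ s → inner ℝ (S s u₀) (phiOne N) = inner ℝ u₀ (phiOne N)) ∧
      -- (iii)
      (∃ C : ℝ, 0 < C ∧ ∀ u₀ ∈ (firstEigenspace N)ᗮ, ∀ s, 0 ≤ s →
        ‖S s u₀‖ ≤ C * Real.exp (-s / 2) * ‖u₀‖) ∧
      (∀ m : ℕ, ∃ C : ℝ, 0 < C ∧ ∀ u₀ ∈ (firstEigenspace N)ᗮ, ∀ s, 1 ≤ s →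
        ∃ V : HK N m, toL2K V = S s u₀ ∧ ‖V‖ ≤ C * Real.exp (-s / 2) * ‖u₀‖) ∧
      -- (iv)
      (∀ u₀ ∈ (firstEigenspace N)ᗮ, ∀ s, 0 < s →
        ∃ f : L2K N, IsL (S s u₀) f ∧
          ‖f - ((N : ℝ) / 2) • S s u₀‖ ≤ 1 / (√2 * s) * ‖u₀‖) ∧
      (∀ u₀ ∈ (firstEigenspace N)ᗮ, ∀ s, 0 < s →
        ∃ g : Fin N → L2K N, (∀ i, HasWeakDeriv (Pi.single i 1) (S s u₀) (g i)) ∧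
          (∑ i, ‖g i‖ ^ 2) - (N : ℝ) / 2 * ‖S s u₀‖ ^ 2 ≤ 1 / (2 * s) * ‖u₀‖ ^ 2) := by
  refine ⟨heatS N, isHeatSemigroup_heatS N, fun u => ⟨isSolution_heatS u,
    fun w hw s hs => hw.eq_heatS hs, fun m => smoothInHK_heatS m u, fun s hs =>
      ⟨_, isL_heatS hs u, by simpa using hasDerivAt_heatS hs u⟩⟩,
    fun u s hs => inner_heatS_phiOne hs u,
    ⟨1, one_pos, fun u hu s hs => by simpa using norm_heatS_le_of_mem_orthogonal hu hs⟩,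
    exists_norm_sobolev_le N, fun u _ s hs => ⟨_, isL_heatS hs u, by simpa using norm_heatG_le hs u⟩,
    fun u _ s hs => exists_gradient_heatS hs u⟩
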